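/- A circuit over the gate set $\{\text{Toffoli}, \mathsf{CNOT}, \mathsf{X}\}$ is a sequence of layers of such gates, the gates of one layer acting on pairwise disjoint sets of qubits; its depth is its number of layers and its gate count is its total number of gates. There is a family of circuits $(C_n)_{n\in\mathbb{N}}$ over this gate set, where $C_n$ acts on a register of $n$ qubits and on one additional qubit (a dirty ancilla), such that for every $n$ the circuit $C_n$ implements the $n$-bit incrementer: the operator of $C_n$ is $\mathrm{Inc}_n \otimes I$, where $\mathrm{Inc}_n\,|v\rangle = |v+1 \bmod 2^n\rangle$ for every integer $0 \le v < 2^n$ (written in binary on the $n$ qubits) and $I$ is the identity on the ancilla. In particular, the ancilla may be in an arbitrary unknown state at the start and is returned to that state. As $n\to\infty$, the depth of $C_n$ is $O(\log^2 n)$ and the gate count of $C_n$ is $O(n \log n)$. -/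

import Mathlib

namespace QCircuit

/-- The operator on the state space with computational basis `(ι → Bool)` (one bit per qubit
`i : ι`) that sends each basis state `|x⟩` to the basis state `|f x⟩`. Columns are inputs. -/
def basisOp {ι : Type*} [Fintype ι] [DecidableEq ι] (f : (ι → Bool) → (ι → Bool)) :
    Matrix (ι → Bool) (ι → Bool) ℂ :=
  Matrix.of fun y x => if y = f x then 1 else 0

/-- A gate of the set {Toffoli, CNOT, X}, placed on pairwise distinct qubits of `ι`.
The target is the last qubit argument. -/
inductive Gate (ι : Type*) where
  | X (t : ι) : Gate ι
  | CNOT (c t : ι) (h : c ≠ t) : Gate ι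
  | Toffoli (c₁ c₂ t : ι) (h₁₂ : c₁ ≠ c₂) (h₁ : c₁ ≠ t) (h₂ : c₂ ≠ t) : Gate ι

namespace Gate

variable {ι : Type*} [DecidableEq ι]

/-- The set of qubits on which a gate is placed. -/
def support : Gate ι → Finset ι
  | X t => {t}
  | CNOT c t _ => {c, t}
  | Toffoli c₁ c₂ t _ _ _ => {c₁, c₂, t}

/-- The action of a gate on the labels of the computational basis states: the target bit is
XORed with the product of the control bits. -/
def act : Gate ι → (ι → Bool) → (ι → Bool)
  | X t, x => Function.update x t (!(x t))
  | CNOT c t _, x => Function.update x t (xor (x t) (x c))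
  | Toffoli c₁ c₂ t _ _ _, x => Function.update x t (xor (x t) (x c₁ && x c₂))

/-- The operator of a gate on the whole state space. -/
def op [Fintype ι] (g : Gate ι) : Matrix (ι → Bool) (ι → Bool) ℂ :=
  basisOp g.act

end Gate

/-- A circuit over {Toffoli, CNOT, X} on the qubits `ι`, as a sequence of layers (time steps);
the gates within one layer are placed on pairwise disjoint sets of qubits. -/
structure Circuit (ι : Type*) [DecidableEq ι] where
  layers : List (List (Gate ι))
  disjoint : ∀ L ∈ layers, L.Pairwise fun g h => Disjoint g.support h.support

namespace Circuit

variable {ι : Type*} [DecidableEq ι]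

/-- The number of layers. -/
def depth (C : Circuit ι) : ℕ := C.layers.length

/-- The total number of gates. -/
def gateCount (C : Circuit ι) : ℕ := (C.layers.map List.length).sum

/-- The operator implemented by a circuit: the product of the operators of its gates, the first
gate of the first layer being applied first (hence the rightmost factor). -/
def op [Fintype ι] (C : Circuit ι) : Matrix (ι → Bool) (ι → Bool) ℂ :=
  C.layers.flatten.foldl (fun M g => g.op * M) 1

/-- The circuit `C` implements the operator `U` on the register `α`, using the qubits of `β` as
dirty ancillae: the operator of `C` is `U ⊗ I`. So the ancillae may start in any state, possibly
entangled with the register, and are returned to it. -/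
def ImplementsWithDirty {α β : Type*} [Fintype α] [DecidableEq α] [Fintype β] [DecidableEq β]
    (C : Circuit (α ⊕ β)) (U : Matrix (α → Bool) (α → Bool) ℂ) : Prop :=
  C.op = (Matrix.kronecker U (1 : Matrix (β → Bool) (β → Bool) ℂ)).submatrix
    (Equiv.sumArrowEquivProdArrow α β Bool) (Equiv.sumArrowEquivProdArrow α β Bool)

end Circuit

/-- The incrementer `|v⟩ ↦ |v + 1 mod 2 ^ n⟩` on `n` qubits, where `|v⟩` is the basis state `x`
with `v = Nat.ofBits x = ∑ i, x i * 2 ^ i`. -/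
def incrementer (n : ℕ) : Matrix (Fin n → Bool) (Fin n → Bool) ℂ :=
  Matrix.of fun y x => if Nat.ofBits y = (Nat.ofBits x + 1) % 2 ^ n then 1 else 0

end QCircuit

/-! All gates permute basis states, so everything reduces to a permutation of bit strings. Split the
register into a low block `A` of 3K+6 bits, where K = ⌈log₂ n⌉, and the remaining high block `H`:
the increment is "increment `H` if `A` is all ones", followed by an increment of `A` (`inc_append`).
The second step is cheap, since a ripple of multiply controlled NOTs has size quadratic in |A| =
O(log n) (`exists_slow_inc`). For shorter registers this already suffices.

For the first step, `H` only matters when `A` is all ones, and then NOT gates turn `A` into clean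
zero bits. With w such zeros, a carry tree of logarithmic depth increments about w/3 bits under a
control (`exists_controlledInc`). If those bits are all ones, which is when the carry passes on,
they too can be negated into zeros, so the pool grows by a factor of about 4/3. After O(log n)
rounds of depth O(log n) each, all of `H` is covered (`exists_condInc`, `le_capacity`). When a
condition fails the supposed zeros are arbitrary, so each stage is built to act as the identity
then, computations being undone by their inverses.

The dirty ancilla `b` must replace a control known to be 1. Complementation conjugates the increment
to its inverse (`inc_flip_inc`). Hence undoing a `b`-controlled increment between `b`-controlled
complementations, with `b` toggled by the conjunction of `A` around a second controlled increment,
gives exactly one increment for either value of `b` (`exists_allInc`). -/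

namespace QCircuit

/-! ### Maps supported on a set of bits -/

section Local

variable {ι : Type*}

/-- `f` only changes bits in `S`, in a way that only depends on bits in `S`. -/
def Local (S : Set ι) (f : (ι → Bool) → (ι → Bool)) : Prop :=
  (∀ x, ∀ v ∉ S, f x v = x v) ∧
    ∀ x y, (∀ v ∈ S, x v = y v) → ∀ v ∈ S, f x v = f y v

theorem Local.mono {S T : Set ι} {f : (ι → Bool) → (ι → Bool)} (h : Local S f) (hST : S ⊆ T) :
    Local T f := by
  refine ⟨fun x v hv => h.1 x v fun hS => hv (hST hS), fun x y hxy v hv => ?_⟩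
  by_cases hS : v ∈ S
  · exact h.2 x y (fun u hu => hxy u (hST hu)) v hS
  · rw [h.1 x v hS, h.1 y v hS, hxy v hv]

theorem Local.comp {S : Set ι} {f g : (ι → Bool) → (ι → Bool)} (hf : Local S f)
    (hg : Local S g) : Local S (f ∘ g) :=
  ⟨fun x v hv => (hf.1 _ v hv).trans (hg.1 x v hv), fun x y hxy => hf.2 _ _ (hg.2 x y hxy)⟩

theorem Local.comm {S T : Set ι} {f g : (ι → Bool) → (ι → Bool)} (hf : Local S f)
    (hg : Local T g) (hST : Disjoint S T) (x : ι → Bool) : f (g x) = g (f x) := by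
  have hd := Set.disjoint_left.1 hST
  funext v
  by_cases hS : v ∈ S
  · rw [hg.1 _ v (hd hS), hf.2 (g x) x (fun u hu => hg.1 x u (hd hu)) v hS]
  · rw [hf.1 _ v hS]
    by_cases hT : v ∈ T
    · exact (hg.2 (f x) x (fun u hu => hf.1 x u fun h => hd h hu) v hT).symm
    · rw [hg.1 _ v hT, hg.1 _ v hT, hf.1 _ v hS]

/-- A subcircuit that avoids the target of a later or earlier gate can be moved past the write to
that target; this drives the compute–uncompute calculations below. -/
theorem Local.apply_update [DecidableEq ι] {S : Set ι} {f : (ι → Bool) → (ι → Bool)}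
    (hf : Local S f) {t : ι} (ht : t ∉ S) (x : ι → Bool) (b : Bool) :
    f (Function.update x t b) = Function.update (f x) t b := by
  funext v
  by_cases hv : v = t
  · subst hv
    rw [hf.1 _ v ht]
    simp
  · rw [Function.update_of_ne hv]
    by_cases hS : v ∈ S
    · exact hf.2 _ _ (fun u hu => Function.update_of_ne (fun h => ht (by rwa [← h])) _ _) v hS
    · rw [hf.1 _ v hS, hf.1 _ v hS, Function.update_of_ne hv]

end Local

namespace Gate

variable {ι : Type*} [DecidableEq ι]

theorem act_act (g : Gate ι) (x : ι → Bool) : g.act (g.act x) = x := by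
  funext v
  cases g with
  | X t => by_cases h : v = t <;> simp [act, h]
  | CNOT c t h => by_cases hv : v = t <;> simp [act, hv, h]
  | Toffoli c₁ c₂ t h₁₂ h₁ h₂ => by_cases hv : v = t <;> simp [act, hv, h₁, h₂]

theorem local_act (g : Gate ι) : Local (g.support : Set ι) g.act := by
  constructor
  · intro x v hv
    cases g <;> simp_all [act, support]
  · intro x y h v hv
    cases g <;> simp only [act, support, Finset.coe_insert, Finset.coe_singleton,
      Set.mem_insert_iff, Set.mem_singleton_iff, forall_eq_or_imp, forall_eq,
      Function.update_apply] at * <;> grind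

end Gate

/-! ### Merging sequences of layers -/

section Zip

variable {α : Type*}

/-- Superposition of two sequences of layers. -/
def zipLayers : List (List α) → List (List α) → List (List α)
  | [], M => M
  | L, [] => L
  | a :: L, b :: M => (a ++ b) :: zipLayers L M

theorem mem_zipLayers {L M : List (List α)} {c : List α} (h : c ∈ zipLayers L M) :
    c ∈ L ∨ c ∈ M ∨ ∃ a ∈ L, ∃ b ∈ M, c = a ++ b := by
  induction L generalizing M with
  | nil => exact Or.inr (Or.inl h)
  | cons a L ih =>
    cases M with
    | nil => exact Or.inl h
    | cons b M =>
      rcases List.mem_cons.1 h with rfl | h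
      · exact Or.inr (Or.inr ⟨a, by simp, b, by simp, rfl⟩)
      · rcases ih h with h | h | ⟨a', ha, b', hb, h⟩
        · simp [h]
        · simp [h]
        · exact Or.inr (Or.inr ⟨a', by simp [ha], b', by simp [hb], h⟩)

theorem length_zipLayers (L M : List (List α)) :
    (zipLayers L M).length = max L.length M.length := by
  induction L generalizing M with
  | nil => simp [zipLayers]
  | cons a L ih =>
    cases M with
    | nil => simp [zipLayers]
    | cons b M => simp [zipLayers, ih]

theorem count_zipLayers (L M : List (List α)) :
    ((zipLayers L M).map List.length).sum =
      (L.map List.length).sum + (M.map List.length).sum := by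
  induction L generalizing M with
  | nil => simp [zipLayers]
  | cons a L ih =>
    cases M with
    | nil => simp [zipLayers]
    | cons b M => simp [zipLayers, ih]; omega

end Zip

/-! ### Circuits as permutations of basis labels, with depth and size bounds -/

section Run

variable {ι : Type*} [DecidableEq ι]

/-- The action of a sequence of gates, the head being applied first. -/
def run (L : List (Gate ι)) (x : ι → Bool) : ι → Bool :=
  L.foldl (fun y g => g.act y) x

@[simp] theorem run_nil (x : ι → Bool) : run [] x = x := rfl

@[simp] theorem run_cons (g : Gate ι) (L : List (Gate ι)) (x : ι → Bool) :
    run (g :: L) x = run L (g.act x) := rfl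

@[simp] theorem run_append (L M : List (Gate ι)) (x : ι → Bool) :
    run (L ++ M) x = run M (run L x) := by
  simp [run]

theorem run_run_reverse (L : List (Gate ι)) (x : ι → Bool) : run L (run L.reverse x) = x := by
  induction L generalizing x with
  | nil => rfl
  | cons g L ih => simp [Gate.act_act, ih]

theorem local_run {S : Set ι} (L : List (Gate ι)) (h : ∀ g ∈ L, (g.support : Set ι) ⊆ S) :
    Local S (run L) := by
  induction L with
  | nil => exact ⟨fun _ _ _ => rfl, fun _ _ h => h⟩
  | cons g L ih =>
    exact (ih fun g' hg' => h g' (by simp [hg'])).comp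
      ((Gate.local_act g).mono (h g (by simp)))

/-- Merging moves each layer of `M` ahead of later layers of `L`; disjoint supports make these
commute. -/
theorem run_zipLayers {S T : Set ι} (hST : Disjoint S T) (L M : List (List (Gate ι)))
    (hL : ∀ a ∈ L, ∀ g ∈ a, (g.support : Set ι) ⊆ S)
    (hM : ∀ a ∈ M, ∀ g ∈ a, (g.support : Set ι) ⊆ T) (x : ι → Bool) :
    run (zipLayers L M).flatten x = run M.flatten (run L.flatten x) := by
  induction L generalizing M x with
  | nil => simp [zipLayers]
  | cons a L ih =>
    cases M with
    | nil => simp [zipLayers]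
    | cons b M =>
      have h1 : Local S (run L.flatten) := local_run _ (by
        intro g hg
        obtain ⟨c, hc, hg⟩ := List.mem_flatten.1 hg
        exact hL c (by simp [hc]) g hg)
      have h2 : Local T (run b) := local_run _ (hM b (by simp))
      simp only [zipLayers, List.flatten_cons, run_append]
      rw [ih M (fun c hc => hL c (by simp [hc])) (fun c hc => hM c (by simp [hc])),
        h1.comm h2 hST]

/-- Some circuit on the qubits in `S`, of depth at most `d` and with at most `k` gates, acts on
the basis states as the permutation `f`. -/
def Realizes (S : Set ι) (f : Equiv.Perm (ι → Bool)) (d k : ℕ) : Prop :=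
  ∃ C : Circuit ι, (∀ L ∈ C.layers, ∀ g ∈ L, (g.support : Set ι) ⊆ S) ∧
    (∀ x, run C.layers.flatten x = f x) ∧ C.depth ≤ d ∧ C.gateCount ≤ k

namespace Realizes

variable {S T : Set ι} {f g : Equiv.Perm (ι → Bool)} {d d' k k' : ℕ}

theorem toLocal (h : Realizes S f d k) : Local S f := by
  obtain ⟨C, hS, hf, -⟩ := h
  rw [← show run C.layers.flatten = f from funext hf]
  refine local_run _ fun g hg => ?_
  obtain ⟨c, hc, hg⟩ := List.mem_flatten.1 hg
  exact hS c hc g hg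

theorem mono (h : Realizes S f d k) (hS : S ⊆ T) (hd : d ≤ d') (hk : k ≤ k') :
    Realizes T f d' k' := by
  obtain ⟨C, h1, h2, h3, h4⟩ := h
  exact ⟨C, fun L hL g hg => (h1 L hL g hg).trans hS, h2, h3.trans hd, h4.trans hk⟩

theorem one (S : Set ι) : Realizes S 1 0 0 :=
  ⟨⟨[], by simp⟩, by simp, by simp, by simp [Circuit.depth], by simp [Circuit.gateCount]⟩

theorem mul (hg : Realizes S g d' k') (hf : Realizes S f d k) :
    Realizes S (g * f) (d + d') (k + k') := by
  obtain ⟨C, h1, h2, h3, h4⟩ := hf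
  obtain ⟨C', h1', h2', h3', h4'⟩ := hg
  refine ⟨⟨C.layers ++ C'.layers, ?_⟩, ?_, ?_, ?_, ?_⟩
  · intro L hL
    rcases List.mem_append.1 hL with hL | hL
    · exact C.disjoint L hL
    · exact C'.disjoint L hL
  · intro L hL
    rcases List.mem_append.1 hL with hL | hL
    · exact h1 L hL
    · exact h1' L hL
  · intro x
    simp [h2, h2']
  · simp only [Circuit.depth, List.length_append] at *
    omega
  · simp only [Circuit.gateCount, List.map_append, List.sum_append] at *
    omega

theorem par (hf : Realizes S f d k) (hg : Realizes T g d' k') (hST : Disjoint S T) :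
    Realizes (S ∪ T) (g * f) (max d d') (k + k') := by
  obtain ⟨C, h1, h2, h3, h4⟩ := hf
  obtain ⟨C', h1', h2', h3', h4'⟩ := hg
  refine ⟨⟨zipLayers C.layers C'.layers, ?_⟩, ?_, ?_, ?_, ?_⟩
  · intro L hL
    rcases mem_zipLayers hL with hL | hL | ⟨a, ha, b, hb, rfl⟩
    · exact C.disjoint L hL
    · exact C'.disjoint L hL
    · refine List.pairwise_append.2 ⟨C.disjoint a ha, C'.disjoint b hb, fun u hu v hv => ?_⟩
      rw [← Finset.disjoint_coe]
      exact hST.mono (h1 a ha u hu) (h1' b hb v hv)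
  · intro L hL
    rcases mem_zipLayers hL with hL | hL | ⟨a, ha, b, hb, rfl⟩
    · exact fun u hu => (h1 L hL u hu).trans Set.subset_union_left
    · exact fun u hu => (h1' L hL u hu).trans Set.subset_union_right
    · intro u hu
      rcases List.mem_append.1 hu with hu | hu
      · exact (h1 a ha u hu).trans Set.subset_union_left
      · exact (h1' b hb u hu).trans Set.subset_union_right
  · intro x
    simp [run_zipLayers hST _ _ h1 h1', h2, h2']
  · simp only [Circuit.depth, length_zipLayers] at *
    omega
  · simp only [Circuit.gateCount, count_zipLayers] at *
    omega

/-- Every gate is an involution, so the circuit read backwards is the inverse at the same cost. -/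
theorem inv (hf : Realizes S f d k) : Realizes S f⁻¹ d k := by
  obtain ⟨C, h1, h2, h3, h4⟩ := hf
  refine ⟨⟨(C.layers.map List.reverse).reverse, ?_⟩, ?_, ?_, ?_, ?_⟩
  · simp only [List.mem_reverse, List.mem_map, forall_exists_index, and_imp,
      forall_apply_eq_imp_iff₂, List.pairwise_reverse]
    exact fun L hL => (C.disjoint L hL).imp fun h => h.symm
  · simp only [List.mem_reverse, List.mem_map, forall_exists_index, and_imp,
      forall_apply_eq_imp_iff₂]
    exact h1
  · intro x
    rw [Equiv.Perm.eq_inv_iff_eq, ← h2, ← List.reverse_flatten, run_run_reverse]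
  · simpa [Circuit.depth] using h3
  · simpa [Circuit.gateCount, Function.comp_def] using h4

theorem gate (g : Gate ι) : Realizes (g.support : Set ι)
    (Function.Involutive.toPerm g.act g.act_act) 1 1 :=
  ⟨⟨[[g]], by simp⟩, by simp, fun _ => rfl, by simp [Circuit.depth], by simp [Circuit.gateCount]⟩

end Realizes

end Run

theorem mem_zip_snd {ι : Type*} {l m : List ι} (h : m.length ≤ l.length) {v : ι} (hv : v ∈ m) :
    ∃ u ∈ l, (u, v) ∈ l.zip m := by
  obtain ⟨i, hi, rfl⟩ := List.getElem_of_mem hv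
  exact ⟨l[i], List.getElem_mem _, List.mem_iff_getElem.2 ⟨i, by simp; omega, by simp⟩⟩

/-! ### Parallel gate layers and fan-out -/

section Basic

variable {ι : Type*} [DecidableEq ι]

open Function

theorem exists_not (t : ι) : ∃ f : Equiv.Perm (ι → Bool), Realizes {t} f 1 1 ∧
    ∀ x, f x = update x t (!x t) :=
  ⟨_, (Realizes.gate (.X t)).mono (by simp [Gate.support]) le_rfl le_rfl, fun _ => rfl⟩

theorem exists_cnot {c t : ι} (h : c ≠ t) : ∃ f : Equiv.Perm (ι → Bool),
    Realizes {c, t} f 1 1 ∧ ∀ x, f x = update x t (x t ^^ x c) :=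
  ⟨_, (Realizes.gate (.CNOT c t h)).mono (by simp [Gate.support]) le_rfl le_rfl, fun _ => rfl⟩

theorem exists_toffoli {c₁ c₂ t : ι} (h : c₁ ≠ c₂) (h₁ : c₁ ≠ t) (h₂ : c₂ ≠ t) :
    ∃ f : Equiv.Perm (ι → Bool), Realizes {c₁, c₂, t} f 1 1 ∧
      ∀ x, f x = update x t (x t ^^ (x c₁ && x c₂)) :=
  ⟨_, (Realizes.gate (.Toffoli c₁ c₂ t h h₁ h₂)).mono (by simp [Gate.support]) le_rfl le_rfl,
    fun _ => rfl⟩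

/-- Parallel composition of a family of circuits on pairwise disjoint sets of qubits. -/
theorem Realizes.parList {α : Type*} (l : List α) (S : α → Set ι)
    (f : α → Equiv.Perm (ι → Bool)) {d k : ℕ} (h : ∀ a ∈ l, Realizes (S a) (f a) d k)
    (hd : l.Pairwise fun a b => Disjoint (S a) (S b)) :
    ∃ F : Equiv.Perm (ι → Bool), Realizes {v | ∃ a ∈ l, v ∈ S a} F d (l.length * k) ∧
      ∀ a ∈ l, ∀ x, ∀ v ∈ S a, F x v = f a x v := by
  induction l with
  | nil => exact ⟨1, (Realizes.one _).mono subset_rfl (Nat.zero_le _) (Nat.zero_le _), by simp⟩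
  | cons a l ih =>
    rw [List.pairwise_cons] at hd
    obtain ⟨F, hF, hFs⟩ := ih (fun b hb => h b (by simp [hb])) hd.2
    have ha := h a (by simp)
    have hdis : Disjoint (S a) {v | ∃ b ∈ l, v ∈ S b} := by
      rw [Set.disjoint_left]
      rintro v hv ⟨b, hb, hvb⟩
      exact Set.disjoint_left.1 (hd.1 b hb) hv hvb
    refine ⟨F * f a, (ha.par hF hdis).mono ?_ (by simp) ?_, ?_⟩
    · rintro v (hv | ⟨b, hb, hv⟩)
      · exact ⟨a, by simp, hv⟩
      · exact ⟨b, by simp [hb], hv⟩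
    · simp only [List.length_cons]
      linarith
    · intro b hb x v hv
      rw [Equiv.Perm.mul_apply]
      rcases List.mem_cons.1 hb with rfl | hb
      · exact hF.toLocal.1 _ v (Set.disjoint_left.1 hdis hv)
      · rw [hFs b hb _ v hv]
        refine (h b (by simp [hb])).toLocal.2 _ _ (fun u hu => ?_) v hv
        exact ha.toLocal.1 _ u (Set.disjoint_right.1 (hd.1 b hb) hu)

theorem pairwise_disjoint_zip {l m : List ι} (h : (l ++ m).Nodup) :
    (l.zip m).Pairwise fun p q => Disjoint ({p.1, p.2} : Set ι) {q.1, q.2} := by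
  induction l generalizing m with
  | nil => simp
  | cons a l ih =>
    cases m with
    | nil => simp
    | cons b m =>
      rw [List.zip_cons_cons, List.pairwise_cons]
      refine ⟨?_, ih ?_⟩
      · rintro ⟨c, d⟩ hcd
        have := List.of_mem_zip hcd
        simp only [Set.disjoint_insert_left, Set.disjoint_singleton_left, Set.mem_insert_iff,
          Set.mem_singleton_iff]
        grind
      · grind

/-- The state `x` with the bits in `l` flipped if `b` is true. -/
def flip (l : List ι) (b : Bool) (x : ι → Bool) : ι → Bool :=
  fun v => if v ∈ l then x v ^^ b else x v

theorem exists_notLayer (l : List ι) (h : l.Nodup) : ∃ f : Equiv.Perm (ι → Bool),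
    Realizes {v | v ∈ l} f 1 l.length ∧ ∀ x, f x = flip l true x := by
  choose f hf hfs using exists_not (ι := ι)
  obtain ⟨F, hF, hFs⟩ := Realizes.parList l (fun a => {a}) f (fun a _ => hf a)
    (h.imp fun h => by simpa using h)
  refine ⟨F, hF.mono (by intro v; simp) le_rfl (by simp), fun x => ?_⟩
  funext v
  by_cases hv : v ∈ l
  · simp [hFs v hv x v, hfs, flip, hv]
  · rw [hF.toLocal.1 x v (by simpa using hv)]
    simp [flip, hv]

theorem exists_cnotLayer (l m : List ι) (h : (l ++ m).Nodup) (hlen : m.length ≤ l.length) :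
    ∃ f : Equiv.Perm (ι → Bool), Realizes {v | v ∈ l ++ m} f 1 m.length ∧
      (∀ x, ∀ v ∉ m, f x v = x v) ∧
      ∀ v ∈ m, ∃ u ∈ l, ∀ x, f x v = (x v ^^ x u) := by
  have hne : ∀ p ∈ l.zip m, p.1 ≠ p.2 := fun p hp => by
    have := List.of_mem_zip hp
    grind
  have hp : ∀ p : ι × ι, ∃ f : Equiv.Perm (ι → Bool), p.1 ≠ p.2 →
      (Realizes {p.1, p.2} f 1 1 ∧ ∀ x, f x = update x p.2 (x p.2 ^^ x p.1)) := fun p => by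
    by_cases h : p.1 = p.2
    · exact ⟨1, fun h' => absurd h h'⟩
    · obtain ⟨f, hf⟩ := exists_cnot h
      exact ⟨f, fun _ => hf⟩
  choose f hf using hp
  obtain ⟨F, hF, hFs⟩ := Realizes.parList (l.zip m) (fun p => {p.1, p.2}) f
    (fun p hp => (hf p (hne p hp)).1) (pairwise_disjoint_zip h)
  refine ⟨F, hF.mono ?_ le_rfl (by simp), fun x v hv => ?_, fun v hv => ?_⟩
  · rintro v ⟨p, hp, hv⟩
    have := List.of_mem_zip hp
    simp only [Set.mem_insert_iff, Set.mem_singleton_iff] at hv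
    simp only [Set.mem_ofPred_eq, List.mem_append]
    grind
  · by_cases h' : ∃ p ∈ l.zip m, v ∈ ({p.1, p.2} : Set ι)
    · obtain ⟨p, hp, hvp⟩ := h'
      rw [hFs p hp x v hvp, (hf p (hne p hp)).2, update_of_ne]
      rintro rfl
      exact hv (List.of_mem_zip (a := p.1) (b := p.2) hp).2
    · exact hF.toLocal.1 x v h'
  · obtain ⟨u, hu, huv⟩ := mem_zip_snd hlen hv
    refine ⟨u, hu, fun x => ?_⟩
    rw [hFs _ huv x v (by simp), (hf _ (hne _ huv)).2]
    simp

/-- Logarithmic-depth fan-out: the bits of `l` are flipped if the bit `q` is set. -/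
theorem exists_fanout (K : ℕ) (q : ι) (l : List ι) (hl : l.length ≤ 2 ^ K)
    (h : (q :: l).Nodup) : ∃ f : Equiv.Perm (ι → Bool),
      Realizes {v | v ∈ q :: l} f (2 * K + 1) (2 * l.length) ∧
      ∀ x, f x = flip l (x q) x := by
  induction K generalizing l with
  | zero =>
    match l, hl with
    | [], _ =>
      exact ⟨1, (Realizes.one _).mono subset_rfl (by simp) (by simp), fun x => by
        funext v; simp [flip]⟩
    | [a], _ =>
      obtain ⟨f, hf, hfs⟩ := exists_cnot (c := q) (t := a) (by grind)
      refine ⟨f, hf.mono (by intro v; simp) (by simp) (by simp), fun x => ?_⟩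
      funext v
      by_cases hv : v = a <;> simp [hfs, flip, hv]
  | succ K ih =>
    obtain ⟨l, m, rfl, h1, h2, h3⟩ : ∃ l₁ l₂, l = l₁ ++ l₂ ∧ l₁.length ≤ 2 ^ K ∧
        l₂.length ≤ l₁.length ∧ l₁.length ≤ l₂.length + 1 := by
      refine ⟨l.take ((l.length + 1) / 2), l.drop ((l.length + 1) / 2), by simp, ?_, ?_, ?_⟩ <;>
        simp only [List.length_take, List.length_drop] <;> rw [pow_succ] at hl <;> omega
    obtain ⟨f, hf, hfs⟩ := ih l h1 (by grind)
    obtain ⟨g, hg, hg1, hg2⟩ := exists_cnotLayer l m (by grind) h2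
    -- Each bit of `m` receives its partner in `l` before and after that partner is flipped by `q`.
    -- The unknown partner value cancels and only the bit `q` remains.
    refine ⟨g * f * g, ((hg.mono (T := {v | v ∈ q :: (l ++ m)}) ?_ le_rfl le_rfl).mul
      ((hf.mono ?_ le_rfl le_rfl).mul (hg.mono ?_ le_rfl le_rfl))).mono subset_rfl
      (by omega) (by simp; omega), fun x => ?_⟩
    · intro v hv
      exact List.mem_cons_of_mem _ hv
    · intro v hv
      simp only [Set.mem_ofPred_eq, List.mem_cons, List.mem_append] at hv ⊢
      tauto
    · intro v hv
      exact List.mem_cons_of_mem _ hv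
    · simp only [Equiv.Perm.mul_apply, hfs]
      have hq : g x q = x q := hg1 x q (by grind)
      funext v
      by_cases hv : v ∈ m
      · obtain ⟨u, hu, hgu⟩ := hg2 v hv
        have hvl : v ∉ l := by grind
        have hum : u ∉ m := by grind
        rw [hgu]
        simp only [flip, hu, hvl, hv, hgu, hq, hg1 x u hum, List.mem_append, if_true, if_false,
          or_true]
        cases x v <;> cases x u <;> simp
      · rw [hg1 _ v hv]
        simp [flip, hv, hq, hg1 x v hv]

end Basic

theorem all_congr {ι : Type*} {l : List ι} {x y : ι → Bool} (h : ∀ v ∈ l, x v = y v) :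
    l.all x = l.all y := by
  induction l with
  | nil => rfl
  | cons a l ih =>
    rw [List.all_cons, List.all_cons, h a (by simp), ih fun v hv => h v (by simp [hv])]

/-! ### Multiply controlled NOT with dirty ancillae, and the ripple incrementer -/

section Increment

variable {ι : Type*} [DecidableEq ι]

open Function

/-- Half of a multiply controlled NOT gate with dirty ancillae `gs`. -/
theorem exists_ladder (t : ι) (cs gs : List ι) (hlen : cs.length ≤ gs.length + 1)
    (h : (t :: (cs ++ gs)).Nodup) : ∃ f : Equiv.Perm (ι → Bool),
      Realizes {v | v ∈ t :: (cs ++ gs)} f (2 * cs.length + 1) (2 * cs.length + 1) ∧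
      (∀ x, f (f x) = x) ∧ (∀ x, ∀ v ∈ cs, f x v = x v) ∧
      ∀ x, f x t = (x t ^^ cs.all x) := by
  induction cs generalizing t gs with
  | nil =>
    obtain ⟨f, hf, hfs⟩ := exists_not t
    exact ⟨f, hf.mono (by simp) (by simp) (by simp), by simp [hfs], by simp, by simp [hfs]⟩
  | cons c cs ih =>
    cases gs with
    | nil =>
      obtain rfl : cs = [] := by simpa using hlen
      have hct : c ≠ t := by grind
      obtain ⟨f, hf, hfs⟩ := exists_cnot hct
      exact ⟨f, hf.mono (by intro v; simp; tauto) (by simp) (by simp), by simp [hfs, hct],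
        by simp [hfs, hct], by simp [hfs]⟩
    | cons g gs =>
      obtain ⟨ℓ, hℓ, hi, hc, ht⟩ := ih g gs (by simp at hlen; omega) (by grind)
      have hcg : c ≠ g := by grind
      have hct : c ≠ t := by grind
      have hgt : g ≠ t := by grind
      obtain ⟨f, hf, hfs⟩ := exists_toffoli hcg hct hgt
      have hinv : ∀ x, f (f x) = x := fun x => by simp [hfs, hct, hgt]
      have htS : t ∉ {v | v ∈ g :: (cs ++ gs)} := by simp; grind
      have hcS : c ∉ {v | v ∈ g :: (cs ++ gs)} := by simp; grind
      have hft : ∀ x, ∀ v, v ≠ t → f x v = x v := fun x v hv => by simp [hfs, hv]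
      have hsub : ({c, g, t} : Set ι) ⊆ {v | v ∈ t :: (c :: cs ++ g :: gs)} := by
        intro v; simp; tauto
      -- `ℓ` adds the conjunction of `cs` to `g`, so the two Toffoli gates add c∧g and c∧(g⊕⋀cs) to
      -- `t`. The unknown `g` cancels, but the bits `gs` are left disturbed.
      refine ⟨f * ℓ * f, ((hf.mono hsub le_rfl le_rfl).mul ((hℓ.mono ?_ le_rfl le_rfl).mul
        (hf.mono hsub le_rfl le_rfl))).mono subset_rfl (by simp; omega) (by simp; omega), ?_, ?_, ?_⟩
      · intro v; simp; tauto
      · intro x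
        simp [hinv, hi]
      · intro x v hv
        simp only [Equiv.Perm.mul_apply]
        have hvt : v ≠ t := by grind
        rw [hft _ v hvt]
        rcases List.mem_cons.1 hv with rfl | hv
        · rw [hℓ.toLocal.1 _ v hcS, hft _ v hvt]
        · rw [hc _ v hv, hft _ v hvt]
      · intro x
        have hall : cs.all (f x) = cs.all x := all_congr fun v hv => hft x v (by grind)
        simp only [Equiv.Perm.mul_apply]
        rw [hfs (ℓ (f x)), update_self, hℓ.toLocal.1 _ t htS, hℓ.toLocal.1 _ c hcS, ht, hall,
          hft x c hct, hft x g hgt, hfs x, update_self, List.all_cons]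
        cases x c <;> cases x g <;> cases x t <;> cases cs.all x <;> rfl

/-- Multiply controlled NOT gate with many dirty ancillae. -/
theorem exists_mcx_dirty (t : ι) (cs gs : List ι) (hlen : cs.length ≤ gs.length + 1)
    (h : (t :: (cs ++ gs)).Nodup) : ∃ f : Equiv.Perm (ι → Bool),
      Realizes {v | v ∈ t :: (cs ++ gs)} f (4 * cs.length + 2) (4 * cs.length + 2) ∧
      ∀ x, f x = update x t (x t ^^ cs.all x) := by
  cases cs with
  | nil =>
    obtain ⟨f, hf, hfs⟩ := exists_not t
    exact ⟨f, hf.mono (by simp) (by simp) (by simp), by simp [hfs]⟩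
  | cons c cs =>
    cases gs with
    | nil =>
      obtain rfl : cs = [] := by simpa using hlen
      have hct : c ≠ t := by grind
      obtain ⟨f, hf, hfs⟩ := exists_cnot hct
      exact ⟨f, hf.mono (by intro v; simp; tauto) (by simp) (by simp), by simp [hfs]⟩
    | cons g gs =>
      obtain ⟨ℓ, hℓ, hi, hc, ht⟩ := exists_ladder g cs gs (by simp at hlen; omega) (by grind)
      have hcg : c ≠ g := by grind
      have hct : c ≠ t := by grind
      have hgt : g ≠ t := by grind
      obtain ⟨f, hf, hfs⟩ := exists_toffoli hcg hct hgt
      have htS : t ∉ {v | v ∈ g :: (cs ++ gs)} := by simp; grind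
      have hcS : c ∉ {v | v ∈ g :: (cs ++ gs)} := by simp; grind
      have hsub : ({c, g, t} : Set ι) ⊆ {v | v ∈ t :: (c :: cs ++ g :: gs)} := by
        intro v; simp; tauto
      have hsub' : {v | v ∈ g :: (cs ++ gs)} ⊆ {v | v ∈ t :: (c :: cs ++ g :: gs)} := by
        intro v; simp; tauto
      -- The second `ℓ` is its own inverse and does not touch `t`, so it restores the ancillae that
      -- the first one disturbed.
      refine ⟨ℓ * (f * (ℓ * f)), (((hℓ.mono hsub' le_rfl le_rfl).mul
        ((hf.mono hsub le_rfl le_rfl).mul ((hℓ.mono hsub' le_rfl le_rfl).mul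
        (hf.mono hsub le_rfl le_rfl))))).mono subset_rfl (by simp; omega) (by simp; omega),
        fun x => ?_⟩
      simp only [Equiv.Perm.mul_apply]
      rw [hfs (ℓ _), hfs x, hℓ.toLocal.apply_update htS, hℓ.toLocal.apply_update htS,
        hℓ.toLocal.apply_update htS, hi, update_idem, update_self, update_of_ne hct,
        update_of_ne hgt, hℓ.toLocal.1 _ c hcS, ht, List.all_cons]
      congr 1
      cases x c <;> cases x g <;> cases x t <;> cases cs.all x <;> rfl

/-- Multiply controlled NOT gate with one dirty ancilla. -/
theorem exists_mcx (t d : ι) (cs : List ι) (h : (t :: d :: cs).Nodup) :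
    ∃ f : Equiv.Perm (ι → Bool),
      Realizes {v | v ∈ t :: d :: cs} f (8 * cs.length + 16) (8 * cs.length + 16) ∧
      ∀ x, f x = update x t (x t ^^ cs.all x) := by
  -- Each half of the controls lends dirty ancillae to the gate controlled by the other half.
  obtain ⟨a, b, rfl, h1, h2⟩ : ∃ a b, cs = a ++ b ∧ b.length ≤ a.length ∧
      a.length ≤ b.length + 1 := by
    refine ⟨cs.take ((cs.length + 1) / 2), cs.drop ((cs.length + 1) / 2), by simp, ?_, ?_⟩ <;>
      simp only [List.length_take, List.length_drop] <;> omega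
  obtain ⟨f, hf, hfs⟩ := exists_mcx_dirty t (d :: b) a (by simp; omega)
    (by grind)
  obtain ⟨g, hg, hgs⟩ := exists_mcx_dirty d a (t :: b) (by simp; omega) (by grind)
  have hdt : d ≠ t := by grind
  have hta : t ∉ a := by grind
  have hda : d ∉ a := by grind
  have htb : t ∉ b := by grind
  have hdb : d ∉ b := by grind
  have hf' : Realizes {v | v ∈ t :: d :: (a ++ b)} f (4 * b.length + 6) (4 * b.length + 6) :=
    hf.mono (by intro v; simp; tauto) (by simp; omega) (by simp; omega)
  have hg' : Realizes {v | v ∈ t :: d :: (a ++ b)} g (4 * a.length + 2) (4 * a.length + 2) :=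
    hg.mono (by intro v; simp; tauto) (by simp) (by simp)
  -- A commutator: `f` adds d∧⋀b to `t` and `g` adds ⋀a to `d`. The two contributions to `t` differ
  -- by ⋀a∧⋀b, and the second `g` restores `d`.
  refine ⟨g * (f * (g * f)), (hg'.mul (hf'.mul (hg'.mul hf'))).mono subset_rfl (by simp; omega)
    (by simp; omega), fun x => ?_⟩
  have key : ∀ (l : List ι) (y : ι → Bool) (v : ι) (c : Bool), v ∉ l →
      l.all (update y v c) = l.all y := fun l y v c hv =>
    all_congr fun u hu => update_of_ne (by rintro rfl; exact hv hu) _ _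
  simp only [Equiv.Perm.mul_apply, hfs, hgs, List.all_cons, key _ _ _ _ hta, key _ _ _ _ hda,
    key _ _ _ _ htb, key _ _ _ _ hdb, update_of_ne hdt, update_of_ne hdt.symm, update_self,
    List.all_append]
  funext v
  by_cases hv : v = t
  · subst hv
    simp only [update_self, update_of_ne hdt.symm]
    cases x v <;> cases x d <;> cases a.all x <;> cases b.all x <;> rfl
  · by_cases hv' : v = d
    · subst hv'
      simp [hv]
    · simp [hv, hv']

/-- The increment of the register `l`, the least significant bit being the head. -/
def inc : List ι → (ι → Bool) → (ι → Bool)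
  | [], x => x
  | h :: l, x => update (if x h then inc l x else x) h (!x h)

theorem inc_of_not_mem {l : List ι} {v : ι} (h : v ∉ l) (x : ι → Bool) : inc l x v = x v := by
  induction l with
  | nil => rfl
  | cons a l ih =>
    rw [inc, update_of_ne (by grind)]
    split
    · exact ih (by grind)
    · rfl

/-- The carry leaves the low block exactly when that block is all ones. The high block goes first,
while the low block still has its old value. -/
theorem inc_append {l m : List ι} (h : (l ++ m).Nodup) (x : ι → Bool) :
    inc (l ++ m) x = inc l (if l.all x then inc m x else x) := by
  induction l with
  | nil => simp [inc]
  | cons a l ih =>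
    have ha : (if (a :: l).all x then inc m x else x) a = x a := by
      split
      · exact inc_of_not_mem (by grind) x
      · rfl
    rw [List.cons_append, inc, inc, ha, ih (by grind)]
    cases hx : x a <;> simp [hx]

/-- A slow incrementer with one dirty ancilla. -/
theorem exists_slow_inc (d : ι) (l : List ι) (h : (d :: l).Nodup) :
    ∃ f : Equiv.Perm (ι → Bool), Realizes {v | v ∈ d :: l} f
      (l.length * (8 * l.length + 16)) (l.length * (8 * l.length + 16)) ∧ ∀ x, f x = inc l x := by
  induction l using List.reverseRecOn with
  | nil => exact ⟨1, (Realizes.one _).mono subset_rfl (by simp) (by simp), fun x => rfl⟩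
  | append_singleton l a ih =>
    obtain ⟨f, hf, hfs⟩ := ih (by grind)
    obtain ⟨g, hg, hgs⟩ := exists_mcx a d l (by grind)
    -- The top bit is flipped before the lower bits, its controls, are changed.
    refine ⟨f * g, ((hf.mono ?_ le_rfl le_rfl).mul (hg.mono ?_ le_rfl le_rfl)).mono subset_rfl
      ?_ ?_, fun x => ?_⟩
    · intro v; simp; tauto
    · intro v; simp; tauto
    · simp; nlinarith
    · simp; nlinarith
    · rw [inc_append (by grind), Equiv.Perm.mul_apply, hfs, hgs]
      congr 1
      cases l.all x <;> simp [inc]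

end Increment

/-! ### Carry trees: prefix conjunctions in logarithmic depth -/

section Prefix

variable {ι : Type*}

/-- In the state `z`, the second components of the list `l` hold the conjunctions of `a` with the
preceding first components. -/
def IsPrefix : List (ι × ι) → Bool → (ι → Bool) → Prop
  | [], _, _ => True
  | p :: l, a, z => z p.2 = a ∧ IsPrefix l (a && z p.1) z

theorem isPrefix_append (l m : List (ι × ι)) (a : Bool) (z : ι → Bool) :
    IsPrefix (l ++ m) a z ↔
      IsPrefix l a z ∧ IsPrefix m (a && (l.map Prod.fst).all z) z := by
  induction l generalizing a with
  | nil => simp [IsPrefix]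
  | cons p l ih => simp only [List.cons_append, IsPrefix, ih, List.map_cons, List.all_cons,
      Bool.and_assoc, and_assoc]

theorem isPrefix_congr {l : List (ι × ι)} {a : Bool} {x y : ι → Bool}
    (h1 : ∀ v ∈ l.map Prod.fst, x v = y v) (h2 : ∀ v ∈ l.map Prod.snd, x v = y v) :
    IsPrefix l a x ↔ IsPrefix l a y := by
  induction l generalizing a with
  | nil => simp [IsPrefix]
  | cons p l ih =>
    simp only [List.map_cons, List.mem_cons, forall_eq_or_imp] at h1 h2
    rw [IsPrefix, IsPrefix, h1.1, h2.1, ih h1.2 h2.2]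

/-- The prefix bits are determined by the register bits; this identifies a state to be uncomputed
with an image of the computation. -/
theorem IsPrefix.snd_eq {l : List (ι × ι)} {a : Bool} {x y : ι → Bool} (hx : IsPrefix l a x)
    (hy : IsPrefix l a y) (h : ∀ v ∈ l.map Prod.fst, x v = y v) :
    ∀ v ∈ l.map Prod.snd, x v = y v := by
  induction l generalizing a with
  | nil => simp
  | cons p l ih =>
    simp only [List.map_cons, List.mem_cons, forall_eq_or_imp] at h ⊢
    exact ⟨hx.1.trans hy.1.symm, ih hx.2 (by rw [h.1]; exact hy.2) h.2⟩

/-- Binary trees whose leaves hold a register bit and a bit for the conjunction of the preceding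
register bits, and whose nodes hold a bit for the conjunction of the register bits below. -/
inductive Tree (ι : Type*) where
  | leaf (h c : ι) : Tree ι
  | node (l r : Tree ι) (p : ι) : Tree ι

namespace Tree

/-- The pairs of bits at the leaves. -/
def pairs : Tree ι → List (ι × ι)
  | leaf h c => [(h, c)]
  | node l r _ => l.pairs ++ r.pairs

/-- The register bits. -/
def reg (t : Tree ι) : List ι := t.pairs.map Prod.fst

/-- The bits for the prefix conjunctions. -/
def outs (t : Tree ι) : List ι := t.pairs.map Prod.snd

/-- The bits at the nodes. -/
def nodes : Tree ι → List ι
  | leaf _ _ => []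
  | node l r p => p :: (l.nodes ++ r.nodes)

/-- The bit for the conjunction of all register bits. -/
def root : Tree ι → ι
  | leaf h _ => h
  | node _ _ p => p

/-- The first prefix bit. -/
def first : Tree ι → ι
  | leaf _ c => c
  | node l _ _ => l.first

/-- The height of the tree. -/
def height : Tree ι → ℕ
  | leaf _ _ => 0
  | node l r _ => max l.height r.height + 1

/-- The nodes hold the conjunctions of the register bits below. -/
def Valid : Tree ι → (ι → Bool) → Prop
  | leaf _ _, _ => True
  | node l r p, y => y p = (l.reg ++ r.reg).all y ∧ l.Valid y ∧ r.Valid y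

@[simp] theorem reg_node (l r : Tree ι) (p : ι) : (node l r p).reg = l.reg ++ r.reg := by
  simp [reg, pairs]

@[simp] theorem outs_node (l r : Tree ι) (p : ι) : (node l r p).outs = l.outs ++ r.outs := by
  simp [outs, pairs]

theorem Valid.root_eq {t : Tree ι} {y : ι → Bool} (h : t.Valid y) :
    y t.root = t.reg.all y := by
  cases t with
  | leaf h c => simp [root, reg, pairs]
  | node l r p => simpa [root] using h.1

theorem valid_congr {t : Tree ι} {x y : ι → Bool} (h : ∀ v ∈ t.reg ++ t.nodes, x v = y v) :
    t.Valid x ↔ t.Valid y := by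
  induction t with
  | leaf => simp [Valid]
  | node l r p ihl ihr =>
    simp only [reg_node, nodes, List.mem_append, List.mem_cons] at h ihl ihr
    rw [Valid, Valid, h p (by simp), all_congr fun v hv => h v (by simp at hv; tauto),
      ihl fun v hv => h v (by tauto), ihr fun v hv => h v (by tauto)]

theorem root_mem (t : Tree ι) : t.root ∈ t.reg ++ t.nodes := by
  cases t <;> simp [root, reg, nodes, pairs]

theorem first_mem (t : Tree ι) : t.first ∈ t.outs := by
  induction t with
  | leaf => simp [first, outs, pairs]
  | node l r p ihl => simp [first, ihl]

/-- Halving the list of leaves gives logarithmic height; a binary tree with m leaves has m − 1 inner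
nodes. -/
theorem exists_tree (K : ℕ) (hc : List (ι × ι)) (ps : List ι) (hl : hc.length = ps.length + 1)
    (hK : hc.length ≤ 2 ^ K) : ∃ t : Tree ι, t.pairs = hc ∧ t.nodes = ps ∧ t.height ≤ K := by
  induction K generalizing hc ps with
  | zero =>
    match hc, ps, hl, hK with
    | [p], [], _, _ => exact ⟨leaf p.1 p.2, rfl, rfl, le_rfl⟩
  | succ K ih =>
    cases ps with
    | nil =>
      match hc, hl with
      | [p], _ => exact ⟨leaf p.1 p.2, rfl, rfl, Nat.zero_le _⟩
    | cons p ps =>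
      rw [pow_succ] at hK
      simp only [List.length_cons] at hl
      set k := hc.length / 2
      obtain ⟨l, h1, h2, h3⟩ := ih (hc.take k) (ps.take (k - 1)) (by simp; omega)
        (by simp; omega)
      obtain ⟨r, h4, h5, h6⟩ := ih (hc.drop k) (ps.drop (k - 1)) (by simp; omega)
        (by simp; omega)
      exact ⟨node l r p, by simp [pairs, h1, h4], by simp [nodes, h2, h5],
        by simp [height, h3, h6]⟩

variable [DecidableEq ι]

open Function

/-- Upward sweep: one Toffoli per node combines the roots of its two subtrees. Subtrees occupy
disjoint bits and run in parallel, so the depth is the height. -/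
theorem exists_up (t : Tree ι) (h : (t.reg ++ t.nodes).Nodup) :
    ∃ U : Equiv.Perm (ι → Bool), Realizes {v | v ∈ t.reg ++ t.nodes} U t.height t.nodes.length ∧
      ∀ x, (∀ v ∉ t.nodes, U x v = x v) ∧ ((∀ v ∈ t.nodes, x v = false) → t.Valid (U x)) := by
  induction t with
  | leaf => exact ⟨1, (Realizes.one _).mono subset_rfl le_rfl le_rfl, by simp [Valid]⟩
  | node l r p ihl ihr =>
    simp only [reg_node, nodes] at h ⊢
    obtain ⟨U, hU, hUs⟩ := ihl (by grind)
    obtain ⟨V, hV, hVs⟩ := ihr (by grind)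
    have hl := l.root_mem
    have hr := r.root_mem
    obtain ⟨f, hf, hfs⟩ := exists_toffoli (c₁ := l.root) (c₂ := r.root) (t := p) (by grind)
      (by grind) (by grind)
    have hdis : Disjoint {v | v ∈ l.reg ++ l.nodes} {v | v ∈ r.reg ++ r.nodes} := by
      rw [Set.disjoint_left]
      simp only [Set.mem_ofPred_eq]
      grind
    refine ⟨f * (V * U), ((hf.mono (T := {v | v ∈ l.reg ++ r.reg ++ p :: (l.nodes ++ r.nodes)})
      ?_ le_rfl le_rfl).mul ((hU.par hV hdis).mono ?_ le_rfl le_rfl)).mono subset_rfl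
      (by simp [height]) (by simp), fun x => ⟨?_, ?_⟩⟩
    · intro v hv
      simp only [Set.mem_insert_iff, Set.mem_singleton_iff, Set.mem_ofPred_eq] at hv ⊢
      grind
    · intro v hv
      simp only [Set.mem_union, Set.mem_ofPred_eq] at hv ⊢
      grind
    · intro v hv
      simp only [Equiv.Perm.mul_apply, hfs]
      rw [update_of_ne (by grind), (hVs _).1 v (by grind), (hUs _).1 v (by grind)]
    · intro hx
      have hUr : ∀ v ∈ r.reg ++ r.nodes, U x v = x v := fun v hv =>
        hU.toLocal.1 x v (Set.disjoint_right.1 hdis hv)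
      have hVl : ∀ v ∈ l.reg ++ l.nodes, V (U x) v = U x v := fun v hv =>
        hV.toLocal.1 _ v (Set.disjoint_left.1 hdis hv)
      have h1 : l.Valid (V (U x)) :=
        (valid_congr hVl).2 ((hUs x).2 fun v hv => hx v (by grind))
      have h2 : r.Valid (V (U x)) :=
        (hVs _).2 fun v hv => (hUr v (by grind)).trans (hx v (by grind))
      have hp : V (U x) p = false := by
        rw [(hVs _).1 p (by grind), (hUs _).1 p (by grind), hx p (by simp)]
      have h3 : ∀ v, v ≠ p → f (V (U x)) v = V (U x) v := fun v hv => by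
        rw [hfs, update_of_ne hv]
      refine ⟨?_, (valid_congr fun v hv => h3 v (by grind)).2 h1,
        (valid_congr fun v hv => h3 v (by grind)).2 h2⟩
      simp only [Equiv.Perm.mul_apply]
      rw [all_congr fun v hv => h3 v (by grind), hfs, update_self, hp, h1.root_eq, h2.root_eq,
        List.all_append, Bool.false_xor]

/-- Downward sweep: the first prefix bit of a subtree holds the conjunction of everything to its
left. It already serves the left child; for the right child, one Toffoli combines it with the root
of the left child. -/
theorem exists_down (t : Tree ι) (h : (t.reg ++ (t.outs ++ t.nodes)).Nodup) :
    ∃ D : Equiv.Perm (ι → Bool), Realizes {v | v ∈ t.reg ++ (t.outs ++ t.nodes)} D t.height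
      t.nodes.length ∧
      ∀ x, (∀ v ∉ t.outs, D x v = x v) ∧ (t.Valid x →
        (∀ v ∈ t.outs, v ≠ t.first → x v = false) → IsPrefix t.pairs (x t.first) (D x)) := by
  induction t with
  | leaf => exact ⟨1, (Realizes.one _).mono subset_rfl le_rfl le_rfl,
      by simp [Valid, pairs, IsPrefix, first]⟩
  | node l r p ihl ihr =>
    simp only [reg_node, outs_node, nodes] at h ⊢
    obtain ⟨U, hU, hUs⟩ := ihl (h.sublist ((List.sublist_append_left _ _).append
      ((List.sublist_append_left _ _).append ((List.sublist_append_left _ _).cons _))))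
    obtain ⟨V, hV, hVs⟩ := ihr (h.sublist ((List.sublist_append_right _ _).append
      ((List.sublist_append_right _ _).append ((List.sublist_append_right _ _).cons _))))
    clear ihl ihr
    simp only [List.nodup_append', List.nodup_cons, List.mem_append, not_or,
      List.Disjoint] at h
    have hl := l.root_mem
    have hlf := l.first_mem
    have hrf := r.first_mem
    obtain ⟨f, hf, hfs⟩ := exists_toffoli (c₁ := l.first) (c₂ := l.root) (t := r.first) (by grind)
      (by grind) (by grind)
    have hdis : Disjoint {v | v ∈ l.reg ++ (l.outs ++ l.nodes)}
        {v | v ∈ r.reg ++ (r.outs ++ r.nodes)} := by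
      rw [Set.disjoint_left]
      simp only [Set.mem_ofPred_eq]
      grind
    refine ⟨(V * U) * f, (((hU.par hV hdis).mono
      (T := {v | v ∈ l.reg ++ r.reg ++ (l.outs ++ r.outs ++ p :: (l.nodes ++ r.nodes))})
      ?_ le_rfl le_rfl).mul (hf.mono ?_ le_rfl le_rfl)).mono subset_rfl
      (by simp [height]; omega) (by simp; omega), fun x => ⟨?_, ?_⟩⟩
    · intro v hv
      simp only [Set.mem_union, Set.mem_ofPred_eq] at hv ⊢
      grind
    · intro v hv
      simp only [Set.mem_insert_iff, Set.mem_singleton_iff, Set.mem_ofPred_eq] at hv ⊢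
      grind
    · intro v hv
      simp only [Equiv.Perm.mul_apply]
      rw [(hVs _).1 v (by grind), (hUs _).1 v (by grind), hfs, update_of_ne (by grind)]
    · rintro ⟨-, hl1, hr1⟩ hx
      have h3 : ∀ v, v ≠ r.first → f x v = x v := fun v hv => by rw [hfs, update_of_ne hv]
      have h4 : f x r.first = (x l.first && l.reg.all x) := by
        rw [hfs, update_self, hx _ (by grind) (by simp only [first]; grind), hl1.root_eq,
          Bool.false_xor]
      have hUr : ∀ v ∈ r.reg ++ (r.outs ++ r.nodes), U (f x) v = f x v := fun v hv =>
        hU.toLocal.1 _ v (Set.disjoint_right.1 hdis hv)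
      have hVl : ∀ v ∈ l.reg ++ (l.outs ++ l.nodes), V (U (f x)) v = U (f x) v := fun v hv =>
        hV.toLocal.1 _ v (Set.disjoint_left.1 hdis hv)
      have h5 : IsPrefix l.pairs (x l.first) (U (f x)) := by
        rw [← h3 l.first (by grind)]
        refine (hUs (f x)).2 ((valid_congr fun v hv => h3 v (by grind)).2 hl1) fun v hv hne => ?_
        rw [h3 v (by grind)]
        exact hx v (by grind) hne
      have h6 : IsPrefix r.pairs (x l.first && l.reg.all x) (V (U (f x))) := by
        rw [← h4, ← hUr r.first (by grind)]
        refine (hVs (U (f x))).2 ((valid_congr fun v hv => ?_).2 hr1) fun v hv hne => ?_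
        · rw [hUr v (by grind), h3 v (by grind)]
        · rw [hUr v (by grind), h3 v hne]
          exact hx v (by grind) (by simp only [first]; grind)
      simp only [Equiv.Perm.mul_apply, pairs, first]
      rw [isPrefix_append]
      refine ⟨(isPrefix_congr (fun v hv => hVl v ?_) fun v hv => hVl v ?_).2 h5, ?_⟩
      · exact List.mem_append_left _ hv
      · exact List.mem_append_right _ (List.mem_append_left _ hv)
      · have : (l.pairs.map Prod.fst).all (V (U (f x))) = l.reg.all x :=
          all_congr fun v hv => by
            have hv' : v ∈ l.reg := hv
            rw [hVl v (by grind), (hUs _).1 v (by grind), h3 v (by grind)]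
        rw [this]
        exact h6

end Tree

end Prefix

/-- While the carry is 1, the complemented sum bit ¬(h⊕1) equals the original h; once the carry is
0, it stays 0 whatever follows. So the carries of an increment are also those of the complemented
result, and can be uncomputed from it. -/
theorem isPrefix_of_complement {ι : Type*} {l : List (ι × ι)} {a : Bool} {x y : ι → Bool}
    (hx : IsPrefix l a x) (h1 : ∀ p ∈ l, y p.2 = x p.2)
    (h2 : ∀ p ∈ l, y p.1 = !(x p.1 ^^ x p.2)) : IsPrefix l a y := by
  induction l generalizing a with
  | nil => trivial
  | cons p l ih =>
    obtain ⟨hp, hl⟩ := hx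
    refine ⟨(h1 p (by simp)).trans hp, ?_⟩
    have : (a && y p.1) = (a && x p.1) := by
      rw [h2 p (by simp), hp]
      cases a <;> cases x p.1 <;> rfl
    rw [this]
    exact ih hl (fun r hr => h1 r (by simp [hr])) fun r hr => h2 r (by simp [hr])

theorem pairwise_disjoint_zip₃ {ι : Type*} {g : List ι} {l : List (ι × ι)}
    (h : (g ++ (l.map Prod.fst ++ l.map Prod.snd)).Nodup) :
    (g.zip l).Pairwise fun p q =>
      Disjoint ({p.1, p.2.2, p.2.1} : Set ι) {q.1, q.2.2, q.2.1} := by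
  induction g generalizing l with
  | nil => simp
  | cons a g ih =>
    cases l with
    | nil => simp
    | cons b l =>
      rw [List.zip_cons_cons, List.pairwise_cons]
      refine ⟨?_, ih (h.sublist ((List.sublist_cons_self _ _).append
        ((List.sublist_cons_self _ _).append (List.sublist_cons_self _ _))))⟩
      rintro ⟨c, d⟩ hcd
      have h1 := (List.of_mem_zip hcd).1
      have h2 := List.mem_map_of_mem (f := Prod.fst) (List.of_mem_zip hcd).2
      have h3 := List.mem_map_of_mem (f := Prod.snd) (List.of_mem_zip hcd).2
      simp only [Set.disjoint_insert_left, Set.disjoint_singleton_left, Set.mem_insert_iff,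
        Set.mem_singleton_iff]
      clear ih hcd
      simp only [List.map_cons, List.nodup_append', List.nodup_cons, List.Disjoint, List.mem_cons] at h
      grind

/-! ### Building blocks of the controlled increment -/

section ControlledIncrement

variable {ι : Type*} [DecidableEq ι]

open Function

/-- Prefix conjunctions of the bits `reg` computed into the zero bits `outs` with the help of the
zero bits `nodes`. -/
theorem Tree.exists_prefix (t : Tree ι) (h : (t.reg ++ (t.outs ++ t.nodes)).Nodup) :
    ∃ E : Equiv.Perm (ι → Bool), Realizes {v | v ∈ t.reg ++ (t.outs ++ t.nodes)} E
      (3 * t.height + 1) (3 * t.nodes.length + 1) ∧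
      ∀ x, (∀ v ∈ t.outs ++ t.nodes, x v = false) →
        (∀ v ∉ t.outs, E x v = x v) ∧ IsPrefix t.pairs true (E x) := by
  obtain ⟨U, hU, hUs⟩ := t.exists_up (h.sublist ((List.Sublist.refl _).append
    (List.sublist_append_right _ _)))
  obtain ⟨D, hD, hDs⟩ := t.exists_down h
  obtain ⟨f, hf, hfs⟩ := exists_not t.first
  have hfm := t.first_mem
  simp only [List.nodup_append', List.Disjoint] at h
  have hU' := hU.mono (T := {v | v ∈ t.reg ++ (t.outs ++ t.nodes)})
    (by intro v; simp; tauto) le_rfl le_rfl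
  -- `f` sets the first prefix bit to the empty conjunction. `f` and `D` only change prefix bits,
  -- which `U` avoids, so `U⁻¹` clears the nodes.
  refine ⟨U⁻¹ * (D * (f * U)), (hU'.inv.mul (hD.mul ((hf.mono ?_ le_rfl le_rfl).mul hU'))).mono
    subset_rfl (by omega) (by omega), fun x hx => ?_⟩
  · rintro v rfl
    simp [hfm]
  have hfne : ∀ y v, v ≠ t.first → f y v = y v := fun y v hv => by rw [hfs, update_of_ne hv]
  have hval : t.Valid (f (U x)) :=
    (Tree.valid_congr fun v hv => hfne _ v (by grind)).2
      ((hUs x).2 fun v hv => hx v (by simp [hv]))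
  have hfirst : f (U x) t.first = true := by
    rw [hfs, update_self, (hUs x).1 _ (by grind), hx _ (by simp [hfm]), Bool.not_false]
  have hpre := (hDs (f (U x))).2 hval fun v hv hne => by
    rw [hfne _ v hne, (hUs x).1 v (by grind), hx v (by simp [hv])]
  rw [hfirst] at hpre
  have hDne : ∀ v ∉ t.outs, D (f (U x)) v = U x v := fun v hv => by
    rw [(hDs _).1 v hv, hfne _ v (by grind)]
  have hE : ∀ v ∉ t.outs, (U⁻¹ * (D * (f * U))) x v = x v := fun v hv => by
    simp only [Equiv.Perm.mul_apply]
    by_cases hvS : v ∈ t.reg ++ t.nodes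
    · have := hU.inv.toLocal.2 (D (f (U x))) (U x) (fun u hu => hDne u ?_) v hvS
      · rw [this, Equiv.Perm.inv_eq_iff_eq.2 rfl]
      · have hu' : u ∈ t.reg ++ t.nodes := hu
        grind
    · rw [hU.inv.toLocal.1 _ v hvS, hDne v hv, hU.toLocal.1 _ v hvS]
  refine ⟨hE, (isPrefix_congr (fun v hv => ?_) fun v hv => ?_).2 hpre⟩
  · have hv' : v ∈ t.reg := hv
    rw [hE v (by grind), (hDs _).1 v (by grind), hfne _ v (by grind), (hUs x).1 v (by grind)]
  · have hv' : v ∈ t.outs := hv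
    exact hU.inv.toLocal.1 _ v (by simp; grind)

/-- Conjunction of the bits `hs` and the control `q`, with the help of the zero bits `ps`. -/
theorem exists_and (K : ℕ) (q t : ι) (hs ps : List ι) (hl : hs.length = ps.length + 1)
    (hK : hs.length ≤ 2 ^ K) (h : (q :: t :: (hs ++ ps)).Nodup) :
    ∃ f : Equiv.Perm (ι → Bool), Realizes {v | v ∈ q :: t :: (hs ++ ps)} f (2 * K + 1)
      (2 * hs.length) ∧ (∀ x, x q = false → f x = x) ∧
      ∀ x, (∀ v ∈ ps, x v = false) → f x = update x t (x t ^^ (x q && hs.all x)) := by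
  -- Only the upward sweep is needed, so each leaf repeats its register bit in place of a prefix
  -- bit.
  obtain ⟨T, hT, rfl, hTK⟩ := Tree.exists_tree K (hs.map fun v => (v, v)) ps (by simpa) (by simpa)
  obtain rfl : T.reg = hs := by simp [Tree.reg, hT, Function.comp_def]
  obtain ⟨U, hU, hUs⟩ := T.exists_up (by grind)
  have hr := T.root_mem
  obtain ⟨f, hf, hfs⟩ := exists_toffoli (c₁ := q) (c₂ := T.root) (t := t) (by grind) (by grind)
    (by grind)
  have hqt : q ≠ t := by grind
  have hqS : q ∉ {v | v ∈ T.reg ++ T.nodes} := by simp only [Set.mem_ofPred_eq]; grind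
  have htS : t ∉ {v | v ∈ T.reg ++ T.nodes} := by simp only [Set.mem_ofPred_eq]; grind
  have hU' := hU.mono (T := {v | v ∈ q :: t :: (T.reg ++ T.nodes)})
    (by intro v; simp; tauto) hTK le_rfl
  -- This holds for arbitrary contents of `ps`, which is why a false `q` gives the identity without
  -- clean ancillae.
  have key : ∀ x, (U⁻¹ * (f * U)) x = update x t (x t ^^ (x q && U x T.root)) := fun x => by
    simp only [Equiv.Perm.mul_apply, hfs]
    rw [hU.inv.toLocal.apply_update htS, Equiv.Perm.inv_eq_iff_eq.2 rfl, hU.toLocal.1 _ _ htS,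
      hU.toLocal.1 _ _ hqS]
  refine ⟨U⁻¹ * (f * U), (hU'.inv.mul ((hf.mono ?_ le_rfl le_rfl).mul hU')).mono
    subset_rfl (by omega) (by omega), fun x hx => ?_, fun x hx => ?_⟩
  · intro v hv
    simp only [Set.mem_insert_iff, Set.mem_singleton_iff, Set.mem_ofPred_eq] at hv ⊢
    grind
  · rw [key, hx]
    simp
  · rw [key, ((hUs x).2 hx).root_eq, all_congr fun v hv => (hUs x).1 v (by grind)]

theorem exists_toffoliLayer (g : List ι) (l : List (ι × ι)) (hlen : l.length = g.length)
    (h : (g ++ (l.map Prod.fst ++ l.map Prod.snd)).Nodup) : ∃ f : Equiv.Perm (ι → Bool),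
      Realizes {v | v ∈ g ++ (l.map Prod.fst ++ l.map Prod.snd)} f 1 l.length ∧
      (∀ x, ∀ v ∉ l.map Prod.fst, f x v = x v) ∧
      ∀ p ∈ l, ∃ u ∈ g, ∀ x, f x p.1 = (x p.1 ^^ (x u && x p.2)) := by
  have hmem : ∀ p ∈ g.zip l, p.1 ∈ g ∧ p.2.1 ∈ l.map Prod.fst ∧ p.2.2 ∈ l.map Prod.snd :=
    fun p hp => ⟨(List.of_mem_zip (a := p.1) (b := p.2) hp).1,
      List.mem_map_of_mem (List.of_mem_zip (a := p.1) (b := p.2) hp).2,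
      List.mem_map_of_mem (List.of_mem_zip (a := p.1) (b := p.2) hp).2⟩
  have hne : ∀ p ∈ g.zip l, p.1 ≠ p.2.2 ∧ p.1 ≠ p.2.1 ∧ p.2.2 ≠ p.2.1 := fun p hp => by
    have := hmem p hp
    simp only [List.nodup_append', List.Disjoint] at h
    grind
  have hp : ∀ p : ι × ι × ι, ∃ f : Equiv.Perm (ι → Bool),
      p.1 ≠ p.2.2 ∧ p.1 ≠ p.2.1 ∧ p.2.2 ≠ p.2.1 →
      (Realizes {p.1, p.2.2, p.2.1} f 1 1 ∧
        ∀ x, f x = update x p.2.1 (x p.2.1 ^^ (x p.1 && x p.2.2))) := fun p => by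
    by_cases h : p.1 ≠ p.2.2 ∧ p.1 ≠ p.2.1 ∧ p.2.2 ≠ p.2.1
    · obtain ⟨f, hf⟩ := exists_toffoli h.1 h.2.1 h.2.2
      exact ⟨f, fun _ => hf⟩
    · exact ⟨1, fun h' => absurd h' h⟩
  choose f hf using hp
  obtain ⟨F, hF, hFs⟩ := Realizes.parList (g.zip l) (fun p => {p.1, p.2.2, p.2.1}) f
    (fun p hp => (hf p (hne p hp)).1) (pairwise_disjoint_zip₃ h)
  refine ⟨F, hF.mono ?_ le_rfl (by simp), fun x v hv => ?_, fun p hp => ?_⟩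
  · rintro v ⟨p, hp, hv⟩
    have := hmem p hp
    simp only [Set.mem_insert_iff, Set.mem_singleton_iff] at hv
    simp only [Set.mem_ofPred_eq, List.mem_append]
    rcases hv with rfl | rfl | rfl <;> tauto
  · by_cases h' : ∃ p ∈ g.zip l, v ∈ ({p.1, p.2.2, p.2.1} : Set ι)
    · obtain ⟨p, hp, hvp⟩ := h'
      rw [hFs p hp x v hvp, (hf p (hne p hp)).2, update_of_ne]
      rintro rfl
      exact hv (hmem p hp).2.1
    · exact hF.toLocal.1 x v h'
  · obtain ⟨i, hi, rfl⟩ := List.getElem_of_mem hp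
    have hm : (g[i], l[i]) ∈ g.zip l := List.mem_iff_getElem.2 ⟨i, by simp; omega, by simp⟩
    refine ⟨g[i], List.getElem_mem _, fun x => ?_⟩
    rw [hFs _ hm x _ (by simp), (hf _ (hne _ hm)).2]
    simp

/-- A layer of CNOT gates with a common control `q`, by means of dirty ancillae. -/
theorem exists_controlledLayer (K : ℕ) (q : ι) (g : List ι) (l : List (ι × ι))
    (hlen : l.length = g.length) (hK : l.length ≤ 2 ^ K)
    (h : (q :: (g ++ (l.map Prod.fst ++ l.map Prod.snd))).Nodup) :
    ∃ f : Equiv.Perm (ι → Bool),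
      Realizes {v | v ∈ q :: (g ++ (l.map Prod.fst ++ l.map Prod.snd))} f (4 * K + 4)
        (6 * l.length) ∧
      (∀ x, ∀ v ∉ l.map Prod.fst, f x v = x v) ∧
      ∀ x, ∀ p ∈ l, f x p.1 = (x p.1 ^^ (x q && x p.2)) := by
  have h' := List.nodup_cons.1 h
  obtain ⟨f, hf, hfne, hfs⟩ := exists_toffoliLayer g l hlen h'.2
  obtain ⟨e, he, hes⟩ := exists_fanout K q g (hlen ▸ hK)
    (h.sublist ((List.sublist_append_left _ _).cons_cons _))
  have hf' := hf.mono (T := {v | v ∈ q :: (g ++ (l.map Prod.fst ++ l.map Prod.snd))})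
    (fun v hv => List.mem_cons_of_mem _ hv) le_rfl le_rfl
  have he' := he.mono (T := {v | v ∈ q :: (g ++ (l.map Prod.fst ++ l.map Prod.snd))})
    (by intro v hv; simp only [Set.mem_ofPred_eq, List.mem_cons, List.mem_append] at hv ⊢; tauto)
    le_rfl le_rfl
  have hd1 : ∀ v ∈ g, v ∉ l.map Prod.fst ∧ v ∉ l.map Prod.snd := by
    simp only [List.nodup_append', List.Disjoint] at h'
    grind
  have hd2 : ∀ v ∈ l.map Prod.fst, v ∉ l.map Prod.snd := by
    simp only [List.nodup_append', List.Disjoint] at h'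
    grind
  have hq : q ∉ g ∧ q ∉ l.map Prod.fst := by
    simp only [List.mem_append, not_or] at h'
    tauto
  clear h h'
  -- The Toffoli layer acts with the dirty bit u and then with u⊕q as control, which together adds
  -- q∧`p.2` to the target.
  refine ⟨e * (f * (e * f)), (he'.mul (hf'.mul (he'.mul hf'))).mono subset_rfl (by omega)
    (by omega), fun x v hv => ?_, fun x p hp => ?_⟩
  · simp only [Equiv.Perm.mul_apply, hes, hfne _ q hq.2]
    by_cases hvg : v ∈ g
    · simp [flip, hvg, hfne _ v hv, hq.1, hfne _ q hq.2]
    · simp [flip, hvg, hfne _ v hv]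
  · obtain ⟨u, hu, hfu⟩ := hfs p hp
    have h1 : p.1 ∈ l.map Prod.fst := List.mem_map_of_mem hp
    have h2 : p.2 ∈ l.map Prod.snd := List.mem_map_of_mem hp
    have h3 : p.1 ∉ g := fun h => (hd1 _ h).1 h1
    have h4 : p.2 ∉ g := fun h => (hd1 _ h).2 h2
    have h5 : p.2 ∉ l.map Prod.fst := fun h => hd2 _ h h2
    simp only [Equiv.Perm.mul_apply, hes]
    rw [flip, if_neg h3, hfu, flip, if_neg h3, flip, if_pos hu, flip, if_neg h4, hfu,
      hfne _ u (hd1 u hu).1, hfne _ q hq.2, hfne _ _ h5]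
    cases x p.1 <;> cases x u <;> cases x q <;> cases x p.2 <;> rfl

/-- The prefix conjunction stored beside a bit is the carry into it, so adding it yields the sum
bit; `a` is the carry into the whole register. -/
theorem inc_eq_of_isPrefix {l : List (ι × ι)} {a : Bool} {x y : ι → Bool}
    (h : (l.map Prod.fst ++ l.map Prod.snd).Nodup) (hx : IsPrefix l a x)
    (h1 : ∀ v ∉ l.map Prod.fst, y v = x v) (h2 : ∀ p ∈ l, y p.1 = (x p.1 ^^ x p.2)) :
    y = if a then inc (l.map Prod.fst) x else x := by
  induction l generalizing a y with
  | nil =>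
    have : y = x := funext fun v => h1 v (by simp)
    simp [this, inc]
  | cons p l ih =>
    obtain ⟨hp, hl⟩ := hx
    have hnd : (l.map Prod.fst ++ l.map Prod.snd).Nodup :=
      h.sublist ((List.sublist_cons_self _ _).append (List.sublist_cons_self _ _))
    have hp1 : p.1 ∉ l.map Prod.fst := by
      simp only [List.map_cons, List.cons_append, List.nodup_cons, List.mem_append] at h
      tauto
    have hy := ih (y := update y p.1 (x p.1)) hnd hl (fun v hv => by
      by_cases hvp : v = p.1
      · simp [hvp]
      · rw [update_of_ne hvp, h1 v (by simp only [List.map_cons, List.mem_cons]; tauto)])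
      (fun r hr => by
        rw [update_of_ne, h2 r (by simp [hr])]
        rintro heq
        exact hp1 (heq ▸ List.mem_map_of_mem hr))
    have hyp : y p.1 = (x p.1 ^^ a) := by rw [h2 p (by simp), hp]
    have hyu : y = update (update y p.1 (x p.1)) p.1 (x p.1 ^^ a) := by
      rw [update_idem, ← hyp, update_eq_self]
    rw [hyu, hy, List.map_cons, inc]
    cases a
    · simp
    · cases x p.1 <;> simp

end ControlledIncrement

/-! ### Controlled increment by rounds with a growing pool of zeros -/

section ConditionalIncrement

variable {ι : Type*} [DecidableEq ι]

open Function

theorem local_inc (l : List ι) : Local {v | v ∈ l} (inc l) := by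
  refine ⟨fun x v hv => inc_of_not_mem hv x, fun x y hxy => ?_⟩
  simp only [Set.mem_ofPred_eq] at hxy ⊢
  induction l with
  | nil => simp
  | cons a l ih =>
    intro v hv
    rw [inc, inc, hxy a (by simp)]
    by_cases hva : v = a
    · simp [hva]
    · rw [update_of_ne hva, update_of_ne hva]
      split
      · exact ih (fun u hu => hxy u (by simp [hu])) v (by grind)
      · exact hxy v hv

theorem local_flip (l : List ι) (b : Bool) : Local {v | v ∈ l} (flip l b) := by
  refine ⟨fun x v hv => if_neg hv, fun x y hxy v hv => ?_⟩
  rw [flip, flip, hxy v hv]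

theorem flip_flip (l : List ι) (b : Bool) (x : ι → Bool) : flip l b (flip l b x) = x := by
  funext v
  by_cases hv : v ∈ l <;> simp [flip, hv]

theorem flip_false (l : List ι) (x : ι → Bool) : flip l false x = x := by
  funext v
  simp [flip]

theorem flip_cons (a : ι) (l : List ι) (x : ι → Bool) :
    flip (a :: l) true x = update (flip l true x) a (!x a) := by
  funext v
  by_cases hv : v = a
  · simp [flip, hv]
  · simp [flip, hv]

/-- Complementation is v ↦ −1 − v modulo a power of two, so it conjugates the increment to the
decrement. -/
theorem inc_flip_inc {l : List ι} (h : l.Nodup) (x : ι → Bool) :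
    inc l (flip l true (inc l x)) = flip l true x := by
  induction l generalizing x with
  | nil => funext v; simp [inc, flip]
  | cons a l ih =>
    obtain ⟨ha, hl⟩ := List.nodup_cons.1 h
    simp only [flip_cons, inc, update_self, Bool.not_not]
    cases hx : x a
    · simp only [Bool.false_eq_true, if_false, (local_flip l true).apply_update ha, Bool.not_false,
        update_idem]
    · simp only [if_true, (local_flip l true).apply_update ha, (local_inc l).apply_update ha,
        Bool.not_true, update_idem, ih hl]

/-- Logarithmic-depth controlled incrementer, with ancillae that are zero if the control is set. -/
theorem exists_controlledInc (K : ℕ) (q : ι) (hs W : List ι) (hW : 3 * hs.length ≤ W.length)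
    (hK : hs.length ≤ 2 ^ K) (h : (q :: (hs ++ W)).Nodup) :
    ∃ f : Equiv.Perm (ι → Bool), Realizes {v | v ∈ q :: (hs ++ W)} f (14 * K + 8)
      (16 * hs.length) ∧ (∀ x, x q = false → f x = x) ∧
      ∀ x, x q = true → (∀ v ∈ W, x v = false) → f x = inc hs x := by
  rcases Nat.eq_zero_or_pos hs.length with h0 | h0
  · obtain rfl := List.length_eq_zero_iff.1 h0
    exact ⟨1, (Realizes.one _).mono subset_rfl (Nat.zero_le _) (Nat.zero_le _),
      fun _ _ => rfl, fun _ _ _ => rfl⟩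
  -- `cs` will hold the carries, `gs` the fanned-out control, and `ps` the inner nodes of the carry
  -- tree.
  obtain ⟨cs, gs, ps, W', rfl, hcs, hgs, hps⟩ : ∃ cs gs ps W', W = cs ++ (gs ++ (ps ++ W')) ∧
      cs.length = hs.length ∧ gs.length = hs.length ∧ ps.length + 1 = hs.length := by
    refine ⟨W.take hs.length, (W.drop hs.length).take hs.length,
      ((W.drop hs.length).drop hs.length).take (hs.length - 1),
      ((W.drop hs.length).drop hs.length).drop (hs.length - 1), ?_, ?_, ?_, ?_⟩
    · simp only [List.take_append_drop]
    all_goals simp only [List.length_take, List.length_drop]; omega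
  obtain ⟨l, hl1, hl2⟩ : ∃ l : List (ι × ι), l.map Prod.fst = hs ∧ l.map Prod.snd = cs :=
    ⟨hs.zip cs, List.map_fst_zip hcs.ge, List.map_snd_zip hcs.le⟩
  have hll : l.length = hs.length := by rw [← hl1, List.length_map]
  obtain ⟨T, hT, hTn, hTK⟩ := Tree.exists_tree K l ps (by omega) (by omega)
  have hTr : T.reg = hs := by rw [Tree.reg, hT, hl1]
  have hTo : T.outs = cs := by rw [Tree.outs, hT, hl2]
  have hnd : (hs ++ cs).Nodup := h.sublist ((List.Sublist.append_left
    (List.sublist_append_left _ _) _).trans (List.sublist_cons_self _ _))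
  obtain ⟨E, hE, hEs⟩ := T.exists_prefix (by
    rw [hTr, hTo, hTn]
    refine h.sublist (((List.Sublist.append_left (List.Sublist.append_left ?_ _) _)).trans
      (List.sublist_cons_self _ _))
    exact (List.sublist_append_left _ _).trans (List.sublist_append_right _ _))
  rw [hTr, hTo, hTn, hT] at *
  have hmem : ∀ v, (v ∈ hs → v ∉ cs ∧ v ∉ gs ∧ v ∉ ps) ∧ (v ∈ cs → v ∉ gs ∧ v ∉ ps) ∧
      (v ∈ gs → v ∉ ps) := by
    simp only [List.nodup_cons, List.nodup_append', List.Disjoint] at h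
    grind
  have hq : q ∉ hs ∧ q ∉ cs ∧ q ∉ gs ∧ q ∉ ps := by
    simp only [List.nodup_cons, List.mem_append, not_or] at h
    tauto
  obtain ⟨m, hm, hmne, hms⟩ := exists_controlledLayer K q gs l (by omega) (by omega) (by
    rw [hl1, hl2]
    simp only [List.nodup_cons, List.nodup_append', List.Disjoint,
      List.mem_append] at h ⊢
    grind)
  obtain ⟨e, he, hes⟩ := exists_fanout K q hs hK
    (h.sublist ((List.sublist_append_left _ _).cons_cons _))
  rw [hl1, hl2] at hm
  rw [hl1] at hmne
  have hsub : ∀ S : List ι, (∀ v ∈ S, v ∈ q :: (hs ++ (cs ++ (gs ++ (ps ++ W'))))) →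
      {v | v ∈ S} ⊆ {v | v ∈ q :: (hs ++ (cs ++ (gs ++ (ps ++ W'))))} := fun S hS => hS
  have hE' := hE.mono (hsub _ (by grind)) (d' := 3 * K + 1) (by omega) le_rfl
  have hm' := hm.mono (hsub _ (by grind)) le_rfl le_rfl
  have he' := he.mono (hsub _ (by grind)) le_rfl le_rfl
  -- Compute the carries, add them under control of `q`, then erase them from the complemented sum
  -- and complement back. If `q` is false, only `E⁻¹ * E` remains.
  refine ⟨e * (E⁻¹ * (e * (m * E))), (he'.mul (hE'.inv.mul (he'.mul (hm'.mul hE')))).mono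
    subset_rfl (by omega) (by omega), fun x hx => ?_, fun x hx hW => ?_⟩
  · have hEq : E x q = false := by
      rw [hE.toLocal.1 x q (by simp only [Set.mem_ofPred_eq, List.mem_append]; tauto), hx]
    have hmE : m (E x) = E x := by
      funext v
      by_cases hv : v ∈ hs
      · rw [← hl1] at hv
        obtain ⟨p, hp, rfl⟩ := List.mem_map.1 hv
        rw [hms _ p hp, hEq]
        simp
      · exact hmne _ v hv
    simp only [Equiv.Perm.mul_apply, hmE, hes, hEq, flip_false]
    rw [Equiv.Perm.inv_eq_iff_eq.2 rfl, hx, flip_false]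
  · obtain ⟨hE1, hE2⟩ := hEs x (by grind)
    set z := E x with hz
    have hzq : z q = true := by rw [hE1 q hq.2.1, hx]
    have hy : m z = inc hs z := by
      have := inc_eq_of_isPrefix (y := m z) (by rw [hl1, hl2]; exact hnd) hE2
        (by rw [hl1]; exact hmne z) (fun p hp => by rw [hms z p hp, hzq, Bool.true_and])
      simpa [hl1] using this
    have hyq : inc hs z q = true := by rw [inc_of_not_mem hq.1, hzq]
    have hw : IsPrefix l true (flip hs true (inc hs z)) := by
      refine isPrefix_of_complement hE2 (fun p hp => ?_) fun p hp => ?_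
      · have hpc : p.2 ∈ cs := hl2 ▸ List.mem_map_of_mem hp
        have hph : p.2 ∉ hs := fun h => ((hmem _).1 h).1 hpc
        rw [flip, if_neg hph, inc_of_not_mem hph]
      · have hph : p.1 ∈ hs := hl1 ▸ List.mem_map_of_mem hp
        rw [flip, if_pos hph, ← hy, hms z p hp, hzq, Bool.true_and, Bool.xor_true]
    -- `u` is the complemented sum with cleared carries. `E u` has the same register and valid
    -- carries, hence equals the state at hand, so `E⁻¹` leads back to `u`.
    obtain ⟨u, hu⟩ : ∃ u : ι → Bool, u = fun v => if v ∈ cs then false else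
      flip hs true (inc hs z) v := ⟨_, rfl⟩
    have huc : ∀ v ∈ cs, u v = false := fun v hv => by rw [hu]; exact if_pos hv
    have hun : ∀ v ∉ cs, u v = flip hs true (inc hs z) v := fun v hv => by rw [hu]; exact if_neg hv
    obtain ⟨hu1, hu2⟩ := hEs u (fun v hv => by
      rcases List.mem_append.1 hv with hv | hv
      · exact huc v hv
      · have hvc : v ∉ cs := fun h => ((hmem v).2.1 h).2 hv
        have hvh : v ∉ hs := fun h => ((hmem v).1 h).2.2 hv
        rw [hun v hvc, flip, if_neg hvh, inc_of_not_mem hvh, hE1 v hvc]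
        exact hW v (by simp [hv]))
    have hEu : E u = flip hs true (inc hs z) := by
      funext v
      by_cases hv : v ∈ cs
      · refine hu2.snd_eq hw (fun w hw => ?_) v (hl2 ▸ hv)
        have hwc : w ∉ cs := ((hmem w).1 (hl1 ▸ hw)).1
        rw [hu1 w hwc, hun w hwc]
      · rw [hu1 v hv, hun v hv]
    have huq : u q = true := by rw [hun q hq.2.1, flip, if_neg hq.1, hyq]
    simp only [Equiv.Perm.mul_apply, ← hz, hy, hes (inc hs z), hyq]
    rw [← hEu, Equiv.Perm.inv_eq_iff_eq.2 rfl, hes, huq]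
    funext v
    by_cases hv : v ∈ hs
    · have hvc := ((hmem v).1 hv).1
      rw [flip, if_pos hv, hun v hvc, flip, if_pos hv,
        (local_inc hs).2 z x (fun w hw => hE1 w ((hmem w).1 hw).1) v hv]
      simp
    · rw [flip, if_neg hv, inc_of_not_mem hv]
      by_cases hvc : v ∈ cs
      · rw [huc v hvc, hW v (by simp [hvc])]
      · rw [hun v hvc, flip, if_neg hv, inc_of_not_mem hv, hE1 v hvc]

/-- The number of bits that can be incremented in `J` rounds, starting from `w` zero bits. -/
def capacity : ℕ → ℕ → ℕ
  | 0, _ => 0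
  | J + 1, w => w / 3 + capacity J (w + w / 3)

/-- Three rounds at least double the pool: (4/3)³ > 2, and the roundings do no harm from w = 3 on
(3, 4, 5, 6). -/
theorem le_capacity (K w : ℕ) (hw : 3 ≤ w) : 2 ^ K * w ≤ w + capacity (3 * K) w := by
  induction K generalizing w with
  | zero => simp [capacity]
  | succ K ih =>
    rw [Nat.mul_succ]
    simp only [capacity]
    set u := w + w / 3 + (w + w / 3) / 3 + (w + w / 3 + (w + w / 3) / 3) / 3 with hu
    have h2 : 2 * w ≤ u := by omega
    have := ih u (by omega)
    have h3 : 2 ^ K * (2 * w) ≤ 2 ^ K * u := Nat.mul_le_mul_left _ h2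
    rw [pow_succ, mul_assoc]
    omega

/-- Controlled incrementer by rounds, where the bits of `Q` are zero, and the bits of `W` are zero
if the control is set. Each round makes the bits it handles into zero bits for the next one. -/
theorem exists_condInc (K J : ℕ) (q : ι) (Q W H : List ι) (hQ : Q.length = J)
    (hW : 3 ≤ W.length) (hH : H.length ≤ capacity J W.length) (hK : H.length ≤ 2 ^ K)
    (h : (q :: (Q ++ (W ++ H))).Nodup) :
    ∃ f : Equiv.Perm (ι → Bool), Realizes {v | v ∈ q :: (Q ++ (W ++ H))} f
      (J * (18 * K + 12)) (22 * H.length) ∧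
      ∀ x, (∀ v ∈ Q, x v = false) → (x q = false → f x = x) ∧
        (x q = true → (∀ v ∈ W, x v = false) → f x = inc H x) := by
  induction J generalizing q Q W H with
  | zero =>
    obtain rfl : H = [] := by simpa [capacity] using hH
    exact ⟨1, (Realizes.one _).mono subset_rfl (Nat.zero_le _) (Nat.zero_le _),
      fun x _ => ⟨fun _ => rfl, fun _ _ => rfl⟩⟩
  | succ J ih =>
    rcases Nat.eq_zero_or_pos H.length with h0 | h0
    · obtain rfl := List.length_eq_zero_iff.1 h0
      exact ⟨1, (Realizes.one _).mono subset_rfl (Nat.zero_le _) (Nat.zero_le _),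
        fun x _ => ⟨fun _ => rfl, fun _ _ => rfl⟩⟩
    obtain ⟨q', Q, rfl⟩ : ∃ a l, Q = a :: l := List.exists_cons_of_length_eq_add_one hQ
    simp only [capacity] at hH
    -- `F` holds the low bits handled in this round; it can be shorter than a third of the pool only
    -- if nothing is left over.
    obtain ⟨F, H, rfl, hF, hF', hF0⟩ : ∃ F H', H = F ++ H' ∧ F.length ≤ W.length / 3 ∧
        (H' = [] ∨ F.length = W.length / 3) ∧ 0 < F.length := by
      refine ⟨H.take (W.length / 3), H.drop (W.length / 3), by simp, by simp, ?_, ?_⟩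
      · rw [← List.length_eq_zero_iff]
        simp only [List.length_take, List.length_drop]
        omega
      · simp only [List.length_take]
        omega
    rw [List.length_append] at *
    have hcap : H.length ≤ capacity J (W ++ F).length := by
      rcases hF' with rfl | hF'
      · simp
      · rw [List.length_append, hF']
        omega
    have hFW : q ∉ F ∧ q ∉ W ∧ q ∉ H ∧ q' ∉ F ∧ q' ∉ H ∧ q ≠ q' ∧ q' ∉ W ∧
        (∀ v ∈ Q, v ∉ F ∧ v ≠ q') ∧ (∀ v ∈ W, v ∉ F ∧ v ∉ H ∧ v ≠ q') ∧
        (∀ v ∈ F, v ∉ H ∧ v ≠ q') := by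
      simp only [List.nodup_cons, List.nodup_append', List.cons_append,
        List.Disjoint, List.mem_append, List.mem_cons, not_or] at h
      grind
    have hFH : (F ++ H).Nodup := h.sublist ((List.sublist_append_right _ _).trans
      ((List.sublist_append_right _ _).trans (List.sublist_cons_self _ _)))
    obtain ⟨g, hg, hgs⟩ := ih q' Q (W ++ F) H (by simpa using hQ) (by simp; omega) hcap
      (by omega) (by simpa using (List.nodup_cons.1 h).2)
    obtain ⟨A, hA, hA0, hA1⟩ := exists_and K q q' F (W.take (F.length - 1))
      (by simp; omega) (by omega) (by
        have : (q :: q' :: (F ++ W)).Nodup := by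
          simp only [List.nodup_cons, List.nodup_append',
            List.cons_append, List.Disjoint, List.mem_append, List.mem_cons, not_or] at h ⊢
          grind
        exact this.sublist ((((List.take_sublist _ _).append_left _).cons_cons _).cons_cons _))
    obtain ⟨N, hN, hNs⟩ := exists_notLayer F hFH.of_append_left
    obtain ⟨k, hk, hk0, hk1⟩ := exists_controlledInc K q F W (by omega) (by omega) (by
      simp only [List.nodup_cons, List.nodup_append',
        List.cons_append, List.Disjoint, List.mem_append, List.mem_cons, not_or] at h ⊢
      grind)
    have hP : Realizes {v | v ∈ q :: q' :: (F ++ W)} (N * A) (2 * K + 1 + 1)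
        (2 * F.length + F.length) := by
      refine (hN.mono ?_ le_rfl le_rfl).mul (hA.mono ?_ le_rfl le_rfl)
      · intro v hv
        simp only [Set.mem_ofPred_eq, List.mem_cons, List.mem_append] at hv ⊢
        tauto
      · intro v hv
        simp only [Set.mem_ofPred_eq, List.mem_cons, List.mem_append] at hv ⊢
        rcases hv with hv | hv | hv | hv
        · tauto
        · tauto
        · tauto
        · exact Or.inr (Or.inr (Or.inr (List.mem_of_mem_take hv)))
    have hPH : Disjoint {v | v ∈ q :: q' :: (F ++ W)} {v | v ∈ H} := by
      rw [Set.disjoint_left]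
      simp only [Set.mem_ofPred_eq, List.mem_cons, List.mem_append]
      grind
    have hcomm := hP.toLocal.comm (local_inc H) hPH
    obtain ⟨P, hPdef⟩ : ∃ P, P = N * A := ⟨_, rfl⟩
    rw [← hPdef] at hP hcomm
    have hPs : ∀ x, P x = flip F true (A x) := fun x => by rw [hPdef, Equiv.Perm.mul_apply, hNs]
    have hsub : ∀ S : List ι, (∀ v ∈ S, v ∈ q :: (q' :: Q ++ (W ++ (F ++ H)))) →
      {v | v ∈ S} ⊆ {v | v ∈ q :: (q' :: Q ++ (W ++ (F ++ H)))} := fun S hS => hS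
    have hP' := hP.mono (hsub _ (by grind)) le_rfl le_rfl
    have hg' := hg.mono (hsub _ (by grind)) le_rfl le_rfl
    have hk' := hk.mono (hsub _ (by grind)) le_rfl le_rfl
    -- `P` writes the carry out of `F` to `q'` and negates `F`, so that `W ++ F` is zero whenever
    -- `q'` is set. After `g` has treated `H`, `P⁻¹` restores `F` and `q'`, and `k` increments `F`.
    refine ⟨k * (P⁻¹ * (g * P)), (hk'.mul (hP'.inv.mul (hg'.mul hP'))).mono subset_rfl
      (by rw [Nat.add_one_mul J]; linarith) (by omega), fun x hx => ⟨fun hq => ?_, fun hq hWx => ?_⟩⟩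
    · have hPx : P x = flip F true x := by rw [hPs, hA0 x hq]
      have hgP : g (P x) = P x := by
        refine (hgs (P x) fun v hv => ?_).1 ?_
        · rw [hPx, flip, if_neg (by grind), hx v (by simp [hv])]
        · rw [hPx, flip, if_neg (by grind), hx q' (by simp)]
      simp only [Equiv.Perm.mul_apply, hgP]
      rw [Equiv.Perm.inv_eq_iff_eq.2 rfl, hk0 x hq]
    · have hPx : P x = flip F true (update x q' (F.all x)) := by
        rw [hPs, hA1 x fun v hv => hWx v (List.mem_of_mem_take hv), hx q' (by simp), hq]
        simp
      have hPq : P x q' = F.all x := by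
        rw [hPx, flip, if_neg (by grind), update_self]
      have hPQ : ∀ v ∈ Q, P x v = false := fun v hv => by
        rw [hPx, flip, if_neg (by grind), update_of_ne (by grind), hx v (by simp [hv])]
      -- `P` does not touch `H`, so it commutes with the increment of `H` and cancels against `P⁻¹`.
      have hkey : P⁻¹ (g (P x)) = if F.all x then inc H x else x := by
        rw [Equiv.Perm.inv_eq_iff_eq]
        split_ifs with hall
        · rw [hcomm]
          refine (hgs (P x) hPQ).2 (hPq.trans hall) fun v hv => ?_
          rcases List.mem_append.1 hv with hv | hv
          · rw [hPx, flip, if_neg (by grind), update_of_ne (by grind), hWx v hv]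
          · rw [hPx, flip, if_pos hv, update_of_ne (by grind), List.all_eq_true.1 hall v hv]
            rfl
        · exact (hgs (P x) hPQ).1 (by rw [hPq]; simpa using hall)
      simp only [Equiv.Perm.mul_apply, hkey]
      rw [inc_append hFH]
      refine hk1 _ ?_ fun v hv => ?_
      · split_ifs
        · rw [inc_of_not_mem (by grind), hq]
        · exact hq
      · split_ifs
        · rw [inc_of_not_mem (by grind), hWx v hv]
        · exact hWx v hv

end ConditionalIncrement

/-! ### Removing the clean control, and the full incrementer -/

section Incrementer

variable {ι : Type*} [DecidableEq ι]

open Function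

/-- Increment of `H` if all bits of `A` are set, for a short register `A`, with one dirty
ancilla. -/
theorem exists_allInc (K : ℕ) (b : ι) (A H : List ι) (hA : A.length = 3 * K + 6)
    (hK : H.length ≤ 2 ^ K) (h : (b :: (A ++ H)).Nodup) :
    ∃ f : Equiv.Perm (ι → Bool), Realizes {v | v ∈ b :: (A ++ H)} f
      (108 * K ^ 2 + 232 * K + 206) (48 * H.length + 60 * K + 152) ∧
      ∀ x, f x = if A.all x then inc H x else x := by
  by_cases hH : H = []
  · subst hH
    exact ⟨1, (Realizes.one _).mono subset_rfl (Nat.zero_le _) (Nat.zero_le _),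
      fun x => by simp [inc]⟩
  -- A bit of `H` serves as the dirty ancilla for the multiply controlled NOT onto `b`.
  obtain ⟨d, hdH⟩ := List.exists_mem_of_ne_nil H hH
  have hcap := le_capacity (K + 1) 3 le_rfl
  have hpos := Nat.one_le_two_pow (n := K)
  rw [pow_succ] at hcap
  -- One control bit for each of 3(K+1) rounds and an initial pool of three zeros: the capacity is
  -- at least 3·2^(K+1) − 3 ≥ 2^K.
  obtain ⟨Q, W, rfl, hQ, hW⟩ : ∃ Q W, A = Q ++ W ∧ Q.length = 3 * (K + 1) ∧ W.length = 3 := by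
    refine ⟨A.take (3 * (K + 1)), A.drop (3 * (K + 1)), by simp, ?_, ?_⟩ <;>
      simp only [List.length_take, List.length_drop] <;> omega
  obtain ⟨g, hg, hgs⟩ := exists_condInc K _ b Q W H hQ hW.ge (by rw [hW]; omega) hK
    (by simpa using h)
  obtain ⟨A, hAdef⟩ : ∃ A, A = Q ++ W := ⟨_, rfl⟩
  rw [← List.append_assoc] at hg
  rw [← hAdef] at hA h hg ⊢
  have hgs' : ∀ x, (∀ v ∈ A, x v = false) → g x = if x b then inc H x else x := fun x hx => by
    have := hgs x fun v hv => hx v (by rw [hAdef]; simp [hv])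
    cases hb : x b
    · simpa using this.1 hb
    · simpa using this.2 hb fun v hv => hx v (by rw [hAdef]; simp [hv])
  clear hgs hAdef
  have hd : (∀ v ∈ A, v ∉ H) ∧ b ∉ A ∧ b ∉ H ∧ d ∉ A ∧ A.Nodup ∧ H.Nodup ∧ b ≠ d := by
    simp only [List.nodup_cons, List.nodup_append', List.Disjoint, List.mem_append, not_or] at h
    grind
  obtain ⟨hAH, hbA, hbH, hdA, hAn, hHn, hbd⟩ := hd
  obtain ⟨N, hN, hNs⟩ := exists_notLayer A hAn
  obtain ⟨m, hm, hms⟩ := exists_mcx b d A (by simp; tauto)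
  obtain ⟨e, he, hes⟩ := exists_fanout K b H hK (by simp; tauto)
  have hall : ∀ x y : ι → Bool, (∀ v ∉ H, v ≠ b → y v = x v) → A.all y = A.all x := fun x y hxy =>
    all_congr fun v hv => hxy v (hAH v hv) (by rintro rfl; exact hbA hv)
  have hallinc : ∀ x, A.all (inc H x) = A.all x := fun x =>
    hall x _ fun v hv _ => inc_of_not_mem hv x
  have hallflip : ∀ x c, A.all (flip H c x) = A.all x := fun x c =>
    hall x _ fun v hv _ => if_neg hv
  -- Negating `A` on both sides turns all ones into the zeros that `g` requires.
  obtain ⟨F, hFdef⟩ : ∃ F, F = N * (g * N) := ⟨_, rfl⟩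
  have hFs : ∀ x, A.all x = true → F x = if x b then inc H x else x := fun x hx => by
    have h1 : ∀ v ∈ A, flip A true x v = false := fun v hv => by
      rw [flip, if_pos hv, List.all_eq_true.1 hx v hv]
      rfl
    simp only [hFdef, Equiv.Perm.mul_apply, hNs]
    rw [hgs' _ h1, flip, if_neg hbA]
    split_ifs with hb
    · rw [(local_flip A true).comm (local_inc H) (by rw [Set.disjoint_left]; exact hAH), flip_flip]
    · exact flip_flip _ _ _
  have hFall : ∀ x, A.all x = true → A.all (F x) = true := fun x hx => by
    rw [hFs x hx]
    split_ifs
    · rw [hallinc, hx]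
    · exact hx
  have hsub : ∀ S : List ι, (∀ v ∈ S, v ∈ b :: (A ++ H)) →
    {v | v ∈ S} ⊆ {v | v ∈ b :: (A ++ H)} := fun S hS => hS
  have hN' := hN.mono (hsub _ (by grind)) le_rfl le_rfl
  have hm' := hm.mono (hsub _ (by grind)) le_rfl le_rfl
  have he' := he.mono (hsub _ (by grind)) le_rfl le_rfl
  have hg' := hg.mono (hsub _ (by grind)) le_rfl le_rfl
  have hF' := hN'.mul (hg'.mul hN')
  rw [← hFdef] at hF'
  -- If `A` is not all ones, `m` is idle and everything cancels. Otherwise `m` toggles `b`: for `b`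
  -- false only `F` acts, giving the increment; for `b` true only `F⁻¹` acts, and the
  -- complementations by `e` turn its decrement into an increment.
  refine ⟨e * (m * (F * (m * (F⁻¹ * e)))), (he'.mul (hm'.mul (hF'.mul (hm'.mul
    (hF'.inv.mul he'))))).mono subset_rfl ?_ ?_, fun x => ?_⟩
  · rw [hA]
    ring_nf
    omega
  · rw [hA]
    omega
  simp only [Equiv.Perm.mul_apply, hes x]
  cases hx : A.all x
  · have h1 : A.all (F⁻¹ (flip H (x b) x)) = false := by
      by_contra hne
      rw [Bool.not_eq_false] at hne
      have := hFall _ hne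
      rw [Equiv.Perm.eq_inv_iff_eq.1 rfl, hallflip, hx] at this
      exact Bool.false_ne_true this
    have h2 : ∀ y, A.all y = false → m y = y := fun y hy => by rw [hms, hy]; simp
    rw [h2 _ h1, Equiv.Perm.eq_inv_iff_eq.1 rfl, h2 _ (by rw [hallflip, hx]), hes,
      flip, if_neg hbH, flip_flip]
    simp
  · have h2 : ∀ y, A.all y = true → m y = update y b (!y b) := fun y hy => by rw [hms, hy]; simp
    have hallu : ∀ x c, A.all (update x b c) = A.all x := fun x c =>
      hall x _ fun v _ hv => update_of_ne hv _ _
    simp only [if_true]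
    cases hb : x b
    · have h3 : F⁻¹ (flip H false x) = x := by
        rw [flip_false, Equiv.Perm.inv_eq_iff_eq, hFs x hx, hb]
        simp
      rw [h3, h2 x hx, hFs _ (by rw [hallu, hx]), update_self, hb, Bool.not_false, if_pos rfl,
        h2 _ (by rw [hallinc, hallu, hx]), (local_inc H).apply_update hbH, update_self,
        update_idem, hes, update_self, Bool.not_true, flip_false]
      rw [← hb, ← inc_of_not_mem hbH x, update_eq_self]
    · have h4 : (flip H true (inc H x)) b = true := by
        rw [flip, if_neg hbH, inc_of_not_mem hbH, hb]
      have h5 : A.all (flip H true (inc H x)) = true := by rw [hallflip, hallinc, hx]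
      have h3 : F⁻¹ (flip H true x) = flip H true (inc H x) := by
        rw [Equiv.Perm.inv_eq_iff_eq, hFs _ h5, h4, if_pos rfl, inc_flip_inc hHn]
      rw [h3, h2 _ h5, h4, hFs _ (by rw [hallu, h5]), update_self, Bool.not_true, if_neg (by simp),
        h2 _ (by rw [hallu, h5]), update_self, Bool.not_false, update_idem,
        update_eq_self_iff.2 h4.symm, hes, h4, flip_flip]

/-- Polylogarithmic-depth incrementer with one dirty ancilla. -/
theorem exists_inc (K : ℕ) (b : ι) (l : List ι) (hK : l.length ≤ 2 ^ K) (h : (b :: l).Nodup) :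
    ∃ f : Equiv.Perm (ι → Bool), Realizes {v | v ∈ b :: l} f
      (600 * (K + 1) ^ 2) (48 * l.length + 600 * (K + 1) ^ 2) ∧ ∀ x, f x = inc l x := by
  by_cases hl : l.length < 3 * K + 6
  · obtain ⟨f, hf, hfs⟩ := exists_slow_inc b l h
    have : l.length * (8 * l.length + 16) ≤ 600 * (K + 1) ^ 2 := by nlinarith
    exact ⟨f, hf.mono subset_rfl this (this.trans (Nat.le_add_left _ _)), hfs⟩
  · obtain ⟨A, H, rfl, hA⟩ : ∃ A H, l = A ++ H ∧ A.length = 3 * K + 6 :=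
      ⟨l.take (3 * K + 6), l.drop (3 * K + 6), by simp, by simp; omega⟩
    rw [List.length_append] at *
    obtain ⟨f, hf, hfs⟩ := exists_allInc K b A H hA (by omega) h
    obtain ⟨g, hg, hgs⟩ := exists_slow_inc b A
      (h.sublist ((List.sublist_append_left _ _).cons_cons _))
    refine ⟨g * f, ((hg.mono ?_ le_rfl le_rfl).mul hf).mono subset_rfl ?_ ?_, fun x => ?_⟩
    · intro v hv
      simp only [Set.mem_ofPred_eq, List.mem_cons, List.mem_append] at hv ⊢
      tauto
    · rw [hA]
      nlinarith
    · rw [hA]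
      nlinarith
    · rw [Equiv.Perm.mul_apply, hgs, hfs, inc_append (List.nodup_cons.1 h).2]

end Incrementer

/-! ### From permutations of labels to operators and binary values -/

section Operator

variable {ι : Type*} [Fintype ι] [DecidableEq ι]

theorem basisOp_mul (f g : (ι → Bool) → (ι → Bool)) :
    basisOp f * basisOp g = basisOp (f ∘ g) := by
  ext y x
  simp [basisOp, Matrix.mul_apply]

theorem basisOp_id : basisOp (id : (ι → Bool) → (ι → Bool)) = 1 := by
  ext y x
  simp [basisOp, Matrix.one_apply]

theorem Circuit.op_eq (C : Circuit ι) : C.op = basisOp (run C.layers.flatten) := by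
  have key : ∀ (L : List (Gate ι)) (f : (ι → Bool) → (ι → Bool)),
      L.foldl (fun M g => g.op * M) (basisOp f) = basisOp (run L ∘ f) := by
    intro L
    induction L with
    | nil => intro f; rfl
    | cons g L ih => intro f; rw [List.foldl_cons, Gate.op, basisOp_mul, ih]; rfl
  rw [Circuit.op, ← basisOp_id, key]
  rfl

/-- The number represented by a register. -/
def value {ι : Type*} : List ι → (ι → Bool) → ℕ
  | [], _ => 0
  | a :: l, x => (x a).toNat + 2 * value l x

theorem value_congr {ι : Type*} {l : List ι} {x y : ι → Bool} (h : ∀ v ∈ l, x v = y v) :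
    value l x = value l y := by
  induction l with
  | nil => rfl
  | cons a l ih => rw [value, value, h a (by simp), ih fun v hv => h v (by simp [hv])]

theorem value_inc {ι : Type*} [DecidableEq ι] {l : List ι} (h : l.Nodup) (x : ι → Bool) :
    value l (inc l x) = (value l x + 1) % 2 ^ l.length := by
  induction l with
  | nil => simp [value]
  | cons a l ih =>
    obtain ⟨ha, hl⟩ := List.nodup_cons.1 h
    have h1 : value l (inc (a :: l) x) = value l (if x a then inc l x else x) :=
      value_congr fun v hv => Function.update_of_ne (by rintro rfl; exact ha hv) _ _
    have hlt : ∀ (m : List ι), value m x < 2 ^ m.length := by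
      intro m
      induction m with
      | nil => simp [value]
      | cons c m ihm =>
        have := Bool.toNat_lt (x c)
        rw [value, List.length_cons, pow_succ]
        omega
    have hl' := hlt l
    rw [value, h1, value, List.length_cons, pow_succ, mul_comm (2 ^ l.length) 2]
    cases hx : x a
    · rw [Nat.mod_eq_of_lt]
      · simp [inc, hx]; omega
      · simp; omega
    · have : (true.toNat + 2 * value l x + 1) = 2 * (value l x + 1) := by simp; omega
      rw [this, Nat.mul_mod_mul_left]
      simp [inc, hx, ih hl]

theorem ofBits_eq_value {n : ℕ} {ι : Type*} (e : Fin n → ι) (x : ι → Bool) :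
    Nat.ofBits (fun i => x (e i)) = value ((List.finRange n).map e) x := by
  induction n with
  | zero => simp [value]
  | succ n ih =>
    rw [Nat.ofBits_succ, List.finRange_succ, List.map_cons, value, List.map_map]
    have := ih (e ∘ Fin.succ)
    simp only [Function.comp_def] at this ⊢
    rw [← this]
    ring

theorem ofBits_injective {n : ℕ} {x y : Fin n → Bool} (h : Nat.ofBits x = Nat.ofBits y) :
    x = y := by
  funext i
  have := congrArg (fun m => m.testBit i) h
  simpa [Nat.testBit_ofBits_lt] using this

/-- An entry of a Kronecker product with the identity is 1 when the register entry is 1 and the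
ancilla labels agree. Injectivity of `Nat.ofBits` turns equal values into equal bits. -/
theorem implements_of_run {n : ℕ} (C : Circuit (Fin n ⊕ Fin 1))
    (h : ∀ x, run C.layers.flatten x = inc ((List.finRange n).map Sum.inl) x) :
    C.ImplementsWithDirty (incrementer n) := by
  set l : List (Fin n ⊕ Fin 1) := (List.finRange n).map Sum.inl with hl
  have hnd : l.Nodup := (List.nodup_finRange n).map Sum.inl_injective
  rw [Circuit.ImplementsWithDirty, Circuit.op_eq, show run C.layers.flatten = inc l from funext h]
  ext y x
  have hinc : Nat.ofBits (fun i => inc l x (Sum.inl i)) =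
      (Nat.ofBits (fun i => x (Sum.inl i)) + 1) % 2 ^ n := by
    rw [ofBits_eq_value, ofBits_eq_value, ← hl, value_inc hnd]
    simp [hl]
  have hr : ∀ j, inc l x (Sum.inr j) = x (Sum.inr j) := fun j =>
    inc_of_not_mem (by simp [hl]) x
  simp only [basisOp, Matrix.of_apply, Matrix.submatrix_apply, Matrix.kronecker,
    Matrix.kroneckerMap_apply, incrementer, Matrix.one_apply, Equiv.sumArrowEquivProdArrow, Equiv.coe_fn_mk, Function.comp_def]
  rw [← hinc, ite_zero_mul_ite_zero, one_mul]
  refine if_congr ⟨?_, ?_⟩ rfl rfl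
  · rintro rfl
    exact ⟨rfl, funext hr⟩
  · rintro ⟨h1, h2⟩
    have h3 := ofBits_injective h1
    funext v
    rcases v with i | j
    · exact congrFun h3 i
    · rw [hr]
      exact congrFun h2 j

end Operator

theorem exists_incrementer_circuit (n : ℕ) : ∃ C : Circuit (Fin n ⊕ Fin 1),
    C.ImplementsWithDirty (incrementer n) ∧ C.depth ≤ 600 * (Nat.clog 2 n + 1) ^ 2 ∧
    C.gateCount ≤ 48 * n + 600 * (Nat.clog 2 n + 1) ^ 2 := by
  obtain ⟨f, ⟨C, -, hC, hd, hg⟩, hf⟩ := exists_inc (Nat.clog 2 n) (Sum.inr 0 : Fin n ⊕ Fin 1)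
    ((List.finRange n).map Sum.inl) (by simpa using Nat.le_pow_clog one_lt_two n)
    (List.nodup_cons.2 ⟨by simp, (List.nodup_finRange n).map Sum.inl_injective⟩)
  exact ⟨C, implements_of_run C fun x => (hC x).trans (hf x), hd, by simpa using hg⟩

/-- The rounding and the summand 1 cost at most 2, and 2 ≤ 2 log₂ n for n ≥ 2. -/
theorem clog_add_one_le (n : ℕ) (hn : 2 ≤ n) :
    ((Nat.clog 2 n + 1 : ℕ) : ℝ) ≤ 3 * Real.logb 2 n := by
  have h1 : 1 ≤ Real.logb 2 n := by
    rw [Real.le_logb_iff_rpow_le one_lt_two (by positivity)]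
    simpa using (by exact_mod_cast hn : (2 : ℝ) ≤ n)
  have h2 : (Nat.clog 2 n : ℝ) < Real.logb 2 n + 1 := by
    have h3 := Real.natCeil_logb_natCast 2 n
    rw [Nat.cast_ofNat] at h3
    rw [← h3]
    exact Nat.ceil_lt_add_one (by linarith)
  push_cast
  linarith

end QCircuit

/-- There are circuits over {Toffoli, CNOT, X}, one for each `n`, that implement the `n`-bit
incrementer with one dirty ancilla qubit, in depth `O(log² n)` and with `O(n log n)` gates. -/
theorem mainTheorem7 :
    ∃ C : (n : ℕ) → QCircuit.Circuit (Fin n ⊕ Fin 1),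
      (∀ n : ℕ, (C n).ImplementsWithDirty (QCircuit.incrementer n)) ∧
      Asymptotics.IsBigO Filter.atTop
        (fun n : ℕ => ((C n).depth : ℝ)) (fun n : ℕ => Real.logb 2 (n : ℝ) ^ 2) ∧
      Asymptotics.IsBigO Filter.atTop
        (fun n : ℕ => ((C n).gateCount : ℝ)) (fun n : ℕ => (n : ℝ) * Real.logb 2 (n : ℝ)) := by
  choose C hC hd hg using QCircuit.exists_incrementer_circuit
  -- 5400 = 600·3², from ⌈log₂ n⌉ + 1 ≤ 3 log₂ n. For the gate count, log₂² n and n are both at most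
  -- n log₂ n, hence 5448 = 5400 + 48.
  refine ⟨C, hC, Asymptotics.IsBigO.of_bound 5400 ?_, Asymptotics.IsBigO.of_bound 5448 ?_⟩
  all_goals
    filter_upwards [Filter.eventually_ge_atTop 2] with n hn
    have h1 := QCircuit.clog_add_one_le n hn
    have hsq : (((Nat.clog 2 n + 1 : ℕ) : ℝ)) ^ 2 ≤ (3 * Real.logb 2 n) ^ 2 :=
      pow_le_pow_left₀ (by positivity) h1 2
    have hlog : 1 ≤ Real.logb 2 n := by
      rw [Real.le_logb_iff_rpow_le one_lt_two (by positivity)]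
      simpa using (by exact_mod_cast hn : (2 : ℝ) ≤ n)
  · have h2 : ((C n).depth : ℝ) ≤ 600 * ((Nat.clog 2 n + 1 : ℕ) : ℝ) ^ 2 := by
      exact_mod_cast hd n
    rw [Real.norm_of_nonneg (by positivity), Real.norm_of_nonneg (by positivity)]
    linarith
  · have h2 : ((C n).gateCount : ℝ) ≤ 48 * n + 600 * ((Nat.clog 2 n + 1 : ℕ) : ℝ) ^ 2 := by
      exact_mod_cast hg n
    have h3 : Real.logb 2 n ≤ n := by
      rw [Real.logb_le_iff_le_rpow one_lt_two (by positivity)]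
      exact_mod_cast n.lt_two_pow_self.le
    rw [Real.norm_of_nonneg (by positivity), Real.norm_of_nonneg (by positivity)]
    nlinarith
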